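/- Let $\mathrm{Geom}(\frac12)$ be the law on $\{0,1,2,\dots\}$ with mass $2^{-(i+1)}$ at $i$, and let $\mathrm{GGW}(\frac12)$ be the law of the family tree of a Galton–Watson branching process with offspring distribution $\mathrm{Geom}(\frac12)$. Let $T$ be the following random infinite tree (the $\mathrm{GGW}_\infty(\frac12)$ tree): start with an infinite path on $\{1,2,3,\dots\}$, graft two $\mathrm{GGW}(\frac12)$ trees onto every $k\ge 1$ (by identifying their roots with $k$), all these trees being independent, and root the result at $1$, with all edges directed towards the root. Let $\alpha\ge 0$. Independently of $T$, place independent $\mathrm{Po}(\alpha)$ numbers of cars at the vertices of $T$. Each vertex has one parking space. The cars arrive one by one; a car parks at the vertex at which it arrives if the space there is empty, and otherwise it drives towards the root and parks in the first empty space it encounters; if there is none, it cannot park. Let $A_\alpha$ be the event that all cars can park on $T$ (in whichever order they arrive). Then $$\mathbb P(A_\alpha)=\begin{cases}\dfrac{\sqrt{1-2\alpha-\alpha^2}}{(1-\alpha)^2\,e^{\alpha}} & \text{if } 0\le\alpha\le\sqrt2-1,\\[2mm] 0 & \text{if } \alpha>\sqrt2-1.\end{cases}$$ -/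

import Mathlib

open MeasureTheory ProbabilityTheory
open scoped NNReal

namespace TreeParking

section Parking

/-! ### The parking process

A rooted tree (or forest) with edges directed towards the root is given by its parent map,
`parent v = none` meaning that `v` is a root. -/

variable {V : Type*}

/-- `ParksAt parent occ v w`: when the spaces in `occ` are taken, a car that is now at `v` and
drives towards the root finds its first empty space at `w`. If there is no such `w`, the car has
to leave the tree. -/
inductive ParksAt (parent : V → Option V) (occ : Set V) : V → V → Prop
  | here {v : V} (hv : v ∉ occ) : ParksAt parent occ v v
  | drive {v u w : V} (hv : v ∈ occ) (hu : parent v = some u) (hw : ParksAt parent occ u w) :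
      ParksAt parent occ v w

/-- The set of spaces that are taken just before step `n`, when the cars arrive one by one:
`arr n = some v` means that at step `n` a car arrives at `v`, and `arr n = none` that no car
arrives at that step. -/
def occupied (parent : V → Option V) (arr : ℕ → Option V) : ℕ → Set V
  | 0 => ∅
  | n + 1 => occupied parent arr n ∪
      {w | ∃ v, arr n = some v ∧ ParksAt parent (occupied parent arr n) v w}

/-- `arr` is an order of arrival of the cars, `cars v` of which arrive at the vertex `v`. -/
def IsArrivalOrder (cars : V → ℕ) (arr : ℕ → Option V) : Prop :=
  ∀ v, {n : ℕ | arr n = some v}.encard = cars v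

/-- All cars can park: in whichever order the cars arrive, each of them finds an empty space. -/
def AllCarsPark (parent : V → Option V) (cars : V → ℕ) : Prop :=
  ∀ arr : ℕ → Option V, IsArrivalOrder cars arr →
    ∀ n v, arr n = some v → ∃ w, ParksAt parent (occupied parent arr n) v w

end Parking

section Trees

/-- The family tree (a set of words, the root being the empty word) in which the individual `w`
has the `k w` children `w ++ [i]`, `i < k w`: a word belongs to the tree if and only if each of
its letters is a legitimate child label. -/
def familyTree (k : List ℕ → ℕ) : Set (List ℕ) :=
  {u | ∀ (w : List ℕ) (i : ℕ), (w ++ [i]) <+: u → i < k w}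

/-- Vertices that may occur in an infinite path `0 ← 1 ← 2 ← ⋯` with two plane trees grafted onto
each of its vertices. The roots of the two trees at `k` are identified with `spine k`, and
`side k b i u` is the vertex with the nonempty word `i :: u` of the tree number `b` at `k`. -/
inductive Vertex
  | spine (k : ℕ)
  | side (k : ℕ) (b : Bool) (i : ℕ) (u : List ℕ)

/-- The parent map; the root is `spine 0`, and the parent of a word is the word without its last
letter. -/
def Vertex.parent : Vertex → Option Vertex
  | .spine 0 => none
  | .spine (k + 1) => some (.spine k)
  | .side k _ _ [] => some (.spine k)
  | .side k b i (j :: u) => some (.side k b i (j :: u).dropLast)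

/-- The vertex set of the tree made of an infinite path with two family trees grafted onto each of
its vertices, `N (k, b, w)` being the number of children that the individual `w` of the tree number
`b` at `k` has within that tree. -/
def spineTree (N : ℕ × Bool × List ℕ → ℕ) : Set Vertex
  | .spine _ => True
  | .side k b i u => i :: u ∈ familyTree (fun w => N (k, b, w))

open Classical in
/-- The cars on the tree `T`, when `P v` cars arrive at each vertex `v` of `T`. -/
noncomputable def carsOn (T : Set Vertex) (P : Vertex → ℕ) (v : Vertex) : ℕ :=
  if v ∈ T then P v else 0

/-- The success probability `1 / 2`. -/
noncomputable def half : unitInterval := ⟨1 / 2, by norm_num, by norm_num⟩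

end Trees

end TreeParking

/-! By a Hall type argument (`allCarsPark_iff`), all cars park exactly when no finite set closed
under parents receives more cars than it has spaces. On a rooted tree this means that the root is
visited at most once, however high the tree is cut (`forall_sum_le_card_iff_visits_le_one`). The
number of visits obeys a recursion: a vertex is visited by its own cars and by all but one of the
cars visiting each child. Independence turns this into recursions for probability generating
functions, collected in `GenFunSystem`.

Write t = 1 - s, and let g(s) be the limit of the generating functions G in a grafted tree, p = g(0)
and b = 2 - t(2 - p). Then g(b - g) = s e^{-αt}. A first order comparison at t = 0 gives p ≥ 1 - α,
with equality if g is the larger root of the quadratic. In that case the discriminant is (1 - 2α -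
α²)t² + O(t³), which is where the threshold √2 - 1 comes from.

Along the path, let w be the limit of the generating functions W, q = w(0), and y = g² e^{αt}. Then
(y - s)w = y t q, where y = s g/(b - g). Above the threshold g is the smaller root somewhere; there
y < s, which forces q = 0 (`ciInf_W_eq_zero`). Below or at it, the discriminant never vanishes for t
> 0, so by continuity g stays the larger root. Then p = 1 - α, and (y - s)/(1 - s) tends to √(1 - 2α
- α²), which identifies q (`ciInf_W_eq`).

Finally, W at 0 factors as G(0)² e^α times the probability of at most one visit at the previous cut,
so the probability sought is q/(p² e^α) (`measureReal_eq`). -/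

namespace TreeParking

/-! ### The parking process and the Hall type criterion. -/

section Parking

variable {V : Type*} {parent : V → Option V} {cars : V → ℕ} {arr : ℕ → Option V}

/-- A set of vertices that contains the parents of its elements. -/
def IsParentClosed (parent : V → Option V) (S : Set V) : Prop :=
  ∀ v ∈ S, ∀ u, parent v = some u → u ∈ S

lemma ParksAt.unique {occ : Set V} {v w w' : V} (h : ParksAt parent occ v w)
    (h' : ParksAt parent occ v w') : w = w' := by
  induction h with
  | here hv =>
    cases h' with
    | here => rfl
    | drive hv' => exact absurd hv' hv
  | drive hv hu _ ih =>
    cases h' with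
    | here hv' => exact absurd hv hv'
    | drive hv' hu' hw' =>
      rw [hu] at hu'
      cases hu'
      exact ih hw'

lemma ParksAt.notMem {occ : Set V} {v w : V} (h : ParksAt parent occ v w) : w ∉ occ := by
  induction h with
  | here hv => exact hv
  | drive _ _ _ ih => exact ih

lemma ParksAt.mem_of_isParentClosed {occ S : Set V} {v w : V} (h : ParksAt parent occ v w)
    (hS : IsParentClosed parent S) (hv : v ∈ S) : w ∈ S := by
  induction h with
  | here _ => exact hv
  | drive _ hu _ ih => exact ih (hS _ hv _ hu)

/-- The vertices from which a car cannot find an empty space. -/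
def stuck (parent : V → Option V) (occ : Set V) : Set V :=
  {v | ¬ ∃ w, ParksAt parent occ v w}

lemma stuck_subset (parent : V → Option V) (occ : Set V) : stuck parent occ ⊆ occ := by
  intro v hv
  by_contra h
  exact hv ⟨v, .here h⟩

lemma isParentClosed_stuck (parent : V → Option V) (occ : Set V) :
    IsParentClosed parent (stuck parent occ) :=
  fun _ hv _ hu ⟨w, hw⟩ => hv ⟨w, .drive (stuck_subset parent occ hv) hu hw⟩

/-- Every space the car passes before `w` is already in `occ`, hence in `occ'`; a later car starting
at `v` would drive on to `w` and be stuck there. So cars parked in the stuck set also arrived in it.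
-/
lemma ParksAt.mem_stuck {occ occ' : Set V} {v w : V} (h : ParksAt parent occ v w)
    (hocc : occ ⊆ occ') (hw : w ∈ stuck parent occ') : v ∈ stuck parent occ' := by
  induction h with
  | here _ => exact hw
  | drive hv hu _ ih =>
    rintro ⟨x, hx⟩
    cases hx with
    | here hv' => exact hv' (hocc hv)
    | drive _ hu' hx' =>
      rw [hu] at hu'
      cases hu'
      exact ih hw ⟨x, hx'⟩

lemma occupied_mono (parent : V → Option V) (arr : ℕ → Option V) :
    Monotone (occupied parent arr) :=
  monotone_nat_of_le_succ fun _ => Set.subset_union_left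

lemma mem_occupied_iff {n : ℕ} {w : V} : w ∈ occupied parent arr n ↔
    ∃ m < n, ∃ v, arr m = some v ∧ ParksAt parent (occupied parent arr m) v w := by
  induction n with
  | zero => simp [occupied]
  | succ n ih =>
    simp only [occupied, Set.mem_union, ih, Set.mem_ofPred_eq, Nat.lt_succ_iff_lt_or_eq,
      or_and_right, exists_or, exists_eq_left]

lemma encard_arrivals (h : IsArrivalOrder cars arr) (S : Finset V) :
    {n : ℕ | ∃ v ∈ S, arr n = some v}.encard = (∑ v ∈ S, cars v : ℕ) := by
  classical
  induction S using Finset.induction_on with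
  | empty => simp
  | insert a S ha ih =>
    rw [Finset.sum_insert ha, Nat.cast_add, ← ih, ← h a, ← Set.encard_union_eq]
    · congr 1
      ext n
      simp
    · rw [Set.disjoint_left]
      rintro n hn ⟨v, hv, hnv⟩
      rw [Set.mem_ofPred_eq] at hn
      rw [hn] at hnv
      cases hnv
      exact ha hv

lemma exists_isArrivalOrder [Countable V] (cars : V → ℕ) :
    ∃ arr : ℕ → Option V, IsArrivalOrder cars arr := by
  classical
  have : Encodable (Σ v, Fin (cars v)) := Encodable.ofCountable _
  -- `decode₂` returns a car only at its own code, so each car arrives exactly once.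
  refine ⟨fun n => (Encodable.decode₂ (Σ v, Fin (cars v)) n).map Sigma.fst, fun v => ?_⟩
  have : {n : ℕ | (Encodable.decode₂ (Σ v, Fin (cars v)) n).map Sigma.fst = some v} =
      (fun i : Fin (cars v) => Encodable.encode (⟨v, i⟩ : Σ v, Fin (cars v))) '' Set.univ := by
    ext n
    simp only [Set.mem_ofPred_eq, Option.map_eq_some_iff, Set.image_univ, Set.mem_range]
    constructor
    · rintro ⟨⟨w, i⟩, h, rfl⟩
      exact ⟨i, Encodable.mem_decode₂.1 h⟩
    · rintro ⟨i, h⟩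
      exact ⟨⟨v, i⟩, Encodable.mem_decode₂.2 h, rfl⟩
  rw [this, Function.Injective.encard_image]
  · simp
  · intro i j hij
    simpa using hij

/-- A Hall type criterion: all cars can park if and only if no finite set of vertices that is
closed under taking parents receives more cars than it has spaces. -/
theorem allCarsPark_iff [Countable V] : AllCarsPark parent cars ↔
    ∀ S : Finset V, IsParentClosed parent (S : Set V) → ∑ v ∈ S, cars v ≤ S.card := by
  classical
  constructor
  · intro h S hS
    obtain ⟨arr, harr⟩ := exists_isArrivalOrder cars
    rcases isEmpty_or_nonempty V with hV | hV
    · simp [Finset.eq_empty_of_isEmpty S]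
    have key : ∀ n : ℕ, (∃ v ∈ S, arr n = some v) →
        ∃ w ∈ S, ∃ v, arr n = some v ∧ ParksAt parent (occupied parent arr n) v w := by
      rintro n ⟨v, hv, hn⟩
      obtain ⟨w, hw⟩ := h arr harr n v hn
      exact ⟨w, hw.mem_of_isParentClosed hS hv, v, hn, hw⟩
    choose! f hfS hf using key
    -- Two cars never take the same space, and cars arriving in `S` park in `S`; hence the arrivals
    -- in `S` inject into `S`.
    have hinj : Set.InjOn f {n : ℕ | ∃ v ∈ S, arr n = some v} := by
      have aux : ∀ m n, (∃ v ∈ S, arr m = some v) → (∃ v ∈ S, arr n = some v) → m < n →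
          f m ≠ f n := by
        intro m n hm hn hmn heq
        obtain ⟨v, -, hv⟩ := hf n hn
        apply hv.notMem
        rw [← heq]
        exact mem_occupied_iff.2 ⟨m, hmn, hf m hm⟩
      intro m hm n hn heq
      rcases lt_trichotomy m n with hlt | rfl | hlt
      · exact absurd heq (aux m n hm hn hlt)
      · rfl
      · exact absurd heq.symm (aux n m hn hm hlt)
    have hle : (f '' {n : ℕ | ∃ v ∈ S, arr n = some v}).encard ≤ (S : Set V).encard :=
      Set.encard_le_encard (by rintro _ ⟨n, hn, rfl⟩; exact hfS n hn)
    rw [hinj.encard_image, encard_arrivals harr, Set.encard_coe_eq_coe_finsetCard] at hle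
    exact_mod_cast hle
  · intro h arr harr n v hn
    by_contra hstuck
    set O := occupied parent arr n with hO
    -- The stuck set violates the criterion: each of its spaces holds an earlier car that arrived in
    -- it, and the car of step `n` is one more.
    have key : ∀ w, w ∈ stuck parent O → ∃ m < n, ∃ v ∈ stuck parent O, arr m = some v ∧
        ParksAt parent (occupied parent arr m) v w := by
      intro w hw
      obtain ⟨m, hm, v, hv, hp⟩ := mem_occupied_iff.1 (stuck_subset parent O hw)
      exact ⟨m, hm, v, hp.mem_stuck (occupied_mono parent arr hm.le) hw, hv, hp⟩
    choose! f hfn hf using key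
    have hinj : Set.InjOn f (stuck parent O) := by
      intro w hw w' hw' heq
      obtain ⟨v, -, hv, hp⟩ := hf w hw
      obtain ⟨v', -, hv', hp'⟩ := hf w' hw'
      rw [← heq, hv] at hv'
      cases hv'
      rw [← heq] at hp'
      exact hp.unique hp'
    have hmaps : f '' stuck parent O ⊆ Finset.range n := by
      rintro _ ⟨w, hw, rfl⟩
      simpa using hfn w hw
    have hfin : (stuck parent O).Finite :=
      Set.Finite.of_finite_image ((Finset.range n).finite_toSet.subset hmaps) hinj
    have hle := h hfin.toFinset (by simpa using isParentClosed_stuck parent O)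
    have hsub : insert n (f '' stuck parent O) ⊆
        {n : ℕ | ∃ v ∈ hfin.toFinset, arr n = some v} := by
      rw [Set.insert_subset_iff]
      constructor
      · exact ⟨v, hfin.mem_toFinset.2 hstuck, hn⟩
      · rintro _ ⟨w, hw, rfl⟩
        obtain ⟨v, hvs, hv, -⟩ := hf w hw
        exact ⟨v, hfin.mem_toFinset.2 hvs, hv⟩
    have hcard := Set.encard_le_encard hsub
    rw [encard_arrivals harr, Set.encard_insert_of_notMem, hinj.encard_image,
      hfin.encard_eq_coe_toFinset_card] at hcard
    · have : hfin.toFinset.card + 1 ≤ ∑ v ∈ hfin.toFinset, cars v := by exact_mod_cast hcard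
      omega
    · intro hmem
      simpa using hmaps hmem

end Parking

/-! ### Counting visits on a deterministic tree. -/

section Visits

variable {V : Type*}

/-- The number of cars that visit `v` (when `P u` cars arrive at each vertex `u`, whose children
are the elements of `ch u`) if the tree is cut `h` levels above `v`. -/
def visits (ch : V → Finset V) (P : V → ℕ) : ℕ → V → ℕ
  | 0, _ => 0
  -- The truncated subtraction removes the car parking at `c`, and gives `0` when no car visits `c`.
  | h + 1, v => P v + ∑ c ∈ ch v, (visits ch P h c - 1)

lemma visits_le_succ (ch : V → Finset V) (P : V → ℕ) (h : ℕ) (v : V) :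
    visits ch P h v ≤ visits ch P (h + 1) v := by
  induction h generalizing v with
  | zero => exact Nat.zero_le _
  | succ h ih =>
    rw [visits, visits]
    gcongr with c
    exact ih c

/-- A balance of cars over `S`. With height `H - depth v` at `v`, all vertices see the same cut at
absolute depth `H`, so the recursion relates the values at parent and child. -/
lemma sum_visits (ch : V → Finset V) (P : V → ℕ) (S : Finset V) (H : ℕ) (depth : V → ℕ)
    (hS : ∀ v ∈ S, depth v < H) (hdepth : ∀ v, ∀ c ∈ ch v, depth c = depth v + 1) :
    ∑ v ∈ S, visits ch P (H - depth v) v =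
      ∑ v ∈ S, P v + ∑ v ∈ S, ∑ c ∈ ch v, (visits ch P (H - depth c) c - 1) := by
  rw [← Finset.sum_add_distrib]
  refine Finset.sum_congr rfl fun v hv => ?_
  have hlt := hS v hv
  obtain ⟨n, hn⟩ : ∃ n, H - depth v = n + 1 := ⟨H - depth v - 1, by omega⟩
  rw [hn, visits]
  congr 1
  refine Finset.sum_congr rfl fun c hc => ?_
  rw [hdepth v c hc, show H - (depth v + 1) = n by omega]

/-- The cars arriving in a rooted tree `T` satisfy the Hall type criterion if and only if the root
is visited by at most one car. -/
theorem forall_sum_le_card_iff_visits_le_one {parent : V → Option V} {ch : V → Finset V}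
    {T : Set V} {r : V} (P : V → ℕ) (depth : V → ℕ)
    (hdepth : ∀ u v, parent v = some u → depth v = depth u + 1)
    (hr : r ∈ T) (hroot : ∀ v, parent v = none ↔ v = r)
    (hparent : ∀ v, ∀ c ∈ ch v, parent c = some v)
    (hmem : ∀ v ∈ T, ∀ c ∈ ch v, c ∈ T)
    (hch : ∀ v, ∀ c ∈ T, parent c = some v → c ∈ ch v) :
    (∀ S : Finset V, (S : Set V) ⊆ T → IsParentClosed parent (S : Set V) →
      ∑ v ∈ S, P v ≤ S.card) ↔ ∀ h, visits ch P h r ≤ 1 := by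
  classical
  have hdepth' : ∀ v, ∀ c ∈ ch v, depth c = depth v + 1 := fun v c hc =>
    hdepth v c (hparent v c hc)
  have hdisj : ∀ S : Finset V, Set.PairwiseDisjoint (S : Set V) ch := by
    intro S u _ v _ huv
    rw [Function.onFun, Finset.disjoint_left]
    intro c hu hv
    have := (hparent u c hu).symm.trans (hparent v c hv)
    exact huv (by simpa using this)
  constructor
  · intro hall h
    by_contra! hvis
    set Z : V → ℕ := fun v => visits ch P (h + depth r - depth v) v with hZ
    have hZr : 2 ≤ Z r := by simpa [hZ, Nat.succ_le_iff] using hvis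
    -- `L k` is generation `k` of the connected component of `r` among the visited vertices; the
    -- violating set is the union of these generations.
    let L : ℕ → Finset V := fun k => Nat.rec {r}
      (fun _ A => A.biUnion fun u => (ch u).filter fun c => 1 ≤ Z c) k
    have hL0 : L 0 = {r} := rfl
    have hLs : ∀ k, L (k + 1) = (L k).biUnion fun u => (ch u).filter fun c => 1 ≤ Z c :=
      fun _ => rfl
    have hLprop : ∀ k, ∀ u ∈ L k, depth u = depth r + k ∧ u ∈ T ∧ 1 ≤ Z u := by
      intro k
      induction k with
      | zero =>
        intro u hu
        rw [hL0, Finset.mem_singleton] at hu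
        subst hu
        exact ⟨rfl, hr, by omega⟩
      | succ k ih =>
        intro c hc
        simp only [hLs, Finset.mem_biUnion, Finset.mem_filter] at hc
        obtain ⟨u, hu, hcu, hZc⟩ := hc
        obtain ⟨hd, hT, -⟩ := ih u hu
        exact ⟨by rw [hdepth' u c hcu, hd, add_assoc], hmem u hT c hcu, hZc⟩
    have hZlt : ∀ u, 1 ≤ Z u → depth u < h + depth r := by
      intro u hu
      by_contra! hle
      have : h + depth r - depth u = 0 := by omega
      simp [hZ, this, visits] at hu
    let S : Finset V := (Finset.range h).biUnion L
    have hSmem : ∀ u, u ∈ S ↔ ∃ k, u ∈ L k := by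
      intro u
      simp only [S, Finset.mem_biUnion, Finset.mem_range]
      constructor
      · rintro ⟨k, -, hk⟩
        exact ⟨k, hk⟩
      · rintro ⟨k, hk⟩
        obtain ⟨hd, -, hZu⟩ := hLprop k u hk
        have := hZlt u hZu
        exact ⟨k, by omega, hk⟩
    have hrS : r ∈ S := (hSmem r).2 ⟨0, by simp [hL0]⟩
    have hclosed : IsParentClosed parent (S : Set V) := by
      intro c hc u hu
      obtain ⟨k, hk⟩ := (hSmem c).1 hc
      cases k with
      | zero =>
        rw [hL0, Finset.mem_singleton] at hk
        rw [(hroot c).2 hk] at hu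
        cases hu
      | succ k =>
        simp only [hLs, Finset.mem_biUnion, Finset.mem_filter] at hk
        obtain ⟨v, hv, hcv, -⟩ := hk
        have := hu.symm.trans (hparent v c hcv)
        have huv : u = v := by simpa using this
        exact (hSmem u).2 ⟨k, huv ▸ hv⟩
    have hST : (S : Set V) ⊆ T := by
      intro u hu
      obtain ⟨k, hk⟩ := (hSmem u).1 hu
      exact (hLprop k u hk).2.1
    have hZS : ∀ u ∈ S, 1 ≤ Z u := by
      intro u hu
      obtain ⟨k, hk⟩ := (hSmem u).1 hu
      exact (hLprop k u hk).2.2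
    have hsum := sum_visits ch P S (h + depth r) depth (fun v hv => hZlt v (hZS v hv)) hdepth'
    change ∑ v ∈ S, Z v = ∑ v ∈ S, P v + ∑ v ∈ S, ∑ c ∈ ch v, (Z c - 1) at hsum
    rw [← Finset.sum_biUnion (hdisj S)] at hsum
    -- A child outside the component is not visited, so no car enters `S` from outside.
    have hle : ∑ c ∈ S.biUnion ch, (Z c - 1) ≤ ∑ c ∈ S.erase r, (Z c - 1) := by
      refine Finset.sum_le_sum_of_ne_zero fun c hc hne => ?_
      obtain ⟨u, hu, hcu⟩ := Finset.mem_biUnion.1 hc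
      obtain ⟨k, hk⟩ := (hSmem u).1 hu
      refine Finset.mem_erase.2 ⟨?_, (hSmem c).2 ⟨k + 1, ?_⟩⟩
      · rintro rfl
        have := hparent u c hcu
        rw [(hroot c).2 rfl] at this
        cases this
      · rw [hLs, Finset.mem_biUnion]
        exact ⟨u, hk, Finset.mem_filter.2 ⟨hcu, by omega⟩⟩
    have hE : ∑ c ∈ S.erase r, Z c = ∑ c ∈ S.erase r, (Z c - 1) + (S.erase r).card := by
      rw [Finset.card_eq_sum_ones, ← Finset.sum_add_distrib]
      refine Finset.sum_congr rfl fun c hc => ?_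
      have := hZS c (Finset.mem_of_mem_erase hc)
      omega
    have h1 := Finset.sum_erase_add S Z hrS
    have h2 := Finset.card_erase_add_one hrS
    have h3 := hall S hST hclosed
    omega
  · intro hvis S hST hclosed
    -- The cut lies beyond all of `S`. For this arbitrary `S` inequalities suffice: cars may enter
    -- from outside, and a space may stay empty.
    set H := S.sup depth + 1 with hH
    set Z : V → ℕ := fun v => visits ch P (H - depth v) v with hZ
    have hsum := sum_visits ch P S H depth
      (fun v hv => Nat.lt_succ_of_le (Finset.le_sup hv)) hdepth'
    change ∑ v ∈ S, Z v = ∑ v ∈ S, P v + ∑ v ∈ S, ∑ c ∈ ch v, (Z c - 1) at hsum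
    rw [← Finset.sum_biUnion (hdisj S)] at hsum
    have hle : ∑ c ∈ S.erase r, (Z c - 1) ≤ ∑ c ∈ S.biUnion ch, (Z c - 1) := by
      refine Finset.sum_le_sum_of_subset fun c hc => ?_
      obtain ⟨hne, hcS⟩ := Finset.mem_erase.1 hc
      obtain ⟨u, hu⟩ := Option.ne_none_iff_exists'.1 (mt (hroot c).1 hne)
      exact Finset.mem_biUnion.2 ⟨u, hclosed c hcS u hu, hch u c (hST hcS) hu⟩
    have hE : ∑ c ∈ S.erase r, Z c ≤ ∑ c ∈ S.erase r, (Z c - 1) + (S.erase r).card := by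
      rw [Finset.card_eq_sum_ones, ← Finset.sum_add_distrib]
      exact Finset.sum_le_sum fun c _ => by omega
    by_cases hrS : r ∈ S
    · have h1 := Finset.sum_erase_add S Z hrS
      have h2 := Finset.card_erase_add_one hrS
      have h3 : Z r ≤ 1 := hvis _
      omega
    · rw [Finset.erase_eq_of_notMem hrS] at hE hle
      omega

end Visits

/-! ### The path with grafted trees as a rooted tree with finite sets of children. -/

section Tree

/-- The distance of a vertex to the root. -/
def Vertex.depth : Vertex → ℕ
  | .spine k => k
  | .side k _ _ u => k + 1 + u.length

lemma Vertex.depth_of_parent (u v : Vertex) (h : v.parent = some u) : v.depth = u.depth + 1 := by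
  match v with
  | .spine 0 => cases h
  | .spine (k + 1) => cases h; rfl
  | .side k _ _ [] => cases h; rfl
  | .side k b i (j :: w) =>
    cases h
    simp only [depth, List.length_dropLast, List.length_cons]
    omega

lemma Vertex.parent_eq_none_iff (v : Vertex) : v.parent = none ↔ v = .spine 0 := by
  match v with
  | .spine 0 => simp [parent]
  | .spine (k + 1) => simp [parent]
  | .side k _ _ [] => simp [parent]
  | .side k b i (j :: w) => simp [parent]

lemma Vertex.parent_side_concat (k : ℕ) (b : Bool) (i : ℕ) (u : List ℕ) (j : ℕ) :
    (Vertex.side k b i (u ++ [j])).parent = some (.side k b i u) := by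
  cases u with
  | nil => rfl
  | cons a u => simp [parent, List.dropLast_cons_of_ne_nil]

instance : Countable Vertex := by
  let f : Vertex → ℕ ⊕ (ℕ × Bool × ℕ × List ℕ) := fun v => match v with
    | .spine k => .inl k
    | .side k b i u => .inr (k, b, i, u)
  refine Function.Injective.countable (f := f) ?_
  rintro (_ | _) (_ | _) h <;> simp_all [f]

open Classical in
/-- The children of a vertex of `spineTree N`. -/
noncomputable def children (N : ℕ × Bool × List ℕ → ℕ) : Vertex → Finset Vertex
  | .spine k => insert (.spine (k + 1))
      ((Finset.range (N (k, false, []))).image (fun i => .side k false i []) ∪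
        (Finset.range (N (k, true, []))).image (fun i => .side k true i []))
  | .side k b i u => (Finset.range (N (k, b, i :: u))).image (fun j => .side k b i (u ++ [j]))

variable (N : ℕ × Bool × List ℕ → ℕ) (P : Vertex → ℕ)

lemma visits_side_succ (h k : ℕ) (b : Bool) (i : ℕ) (u : List ℕ) :
    visits (children N) P (h + 1) (.side k b i u) = P (.side k b i u) +
      ∑ j ∈ Finset.range (N (k, b, i :: u)),
        (visits (children N) P h (.side k b i (u ++ [j])) - 1) := by
  classical
  rw [visits, children, Finset.sum_image]
  intro j _ j' _ h
  simpa using h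

lemma visits_spine_succ (h k : ℕ) :
    visits (children N) P (h + 1) (.spine k) = P (.spine k) +
      ((visits (children N) P h (.spine (k + 1)) - 1) +
      (∑ i ∈ Finset.range (N (k, false, [])),
        (visits (children N) P h (.side k false i []) - 1) +
      ∑ i ∈ Finset.range (N (k, true, [])),
        (visits (children N) P h (.side k true i []) - 1))) := by
  classical
  rw [visits, children, Finset.sum_insert, Finset.sum_union, Finset.sum_image, Finset.sum_image]
  · intro j _ j' _ h
    simpa using h
  · intro j _ j' _ h
    simpa using h
  · rw [Finset.disjoint_left]
    intro x hx hx'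
    simp only [Finset.mem_image] at hx hx'
    obtain ⟨_, _, rfl⟩ := hx
    obtain ⟨_, _, h⟩ := hx'
    simp at h
  · simp

lemma mem_familyTree_concat {k : List ℕ → ℕ} {u : List ℕ} {j : ℕ} :
    u ++ [j] ∈ familyTree k ↔ u ∈ familyTree k ∧ j < k u := by
  simp only [familyTree, Set.mem_ofPred_eq]
  constructor
  · intro h
    exact ⟨fun w i hw => h w i (hw.trans (List.prefix_append _ _)), h u j List.prefix_rfl⟩
  · rintro ⟨h, hj⟩ w i hw
    rw [List.prefix_concat_iff] at hw
    rcases hw with hw | hw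
    · obtain ⟨rfl, hij⟩ := List.append_inj' hw rfl
      rw [List.singleton_inj] at hij
      exact hij ▸ hj
    · exact h w i hw

lemma nil_mem_familyTree (k : List ℕ → ℕ) : [] ∈ familyTree k := by
  intro w i h
  simp at h

lemma spine_mem_spineTree (k : ℕ) : Vertex.spine k ∈ spineTree N := trivial

lemma side_mem_spineTree_iff (k : ℕ) (b : Bool) (i : ℕ) (u : List ℕ) :
    Vertex.side k b i u ∈ spineTree N ↔ i :: u ∈ familyTree fun w => N (k, b, w) := Iff.rfl

lemma side_nil_mem_spineTree_iff (k : ℕ) (b : Bool) (i : ℕ) :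
    Vertex.side k b i [] ∈ spineTree N ↔ i < N (k, b, []) := by
  rw [side_mem_spineTree_iff, ← List.nil_append [i], mem_familyTree_concat]
  simp [nil_mem_familyTree]

lemma side_concat_mem_spineTree_iff (k : ℕ) (b : Bool) (i : ℕ) (u : List ℕ) (j : ℕ) :
    Vertex.side k b i (u ++ [j]) ∈ spineTree N ↔
      Vertex.side k b i u ∈ spineTree N ∧ j < N (k, b, i :: u) := by
  rw [side_mem_spineTree_iff, side_mem_spineTree_iff, ← List.cons_append, mem_familyTree_concat]

lemma parent_eq_of_mem_children (v : Vertex) (c : Vertex) (hc : c ∈ children N v) :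
    c.parent = some v := by
  cases v with
  | spine k =>
    simp only [children, Finset.mem_insert, Finset.mem_union, Finset.mem_image] at hc
    rcases hc with rfl | ⟨i, -, rfl⟩ | ⟨i, -, rfl⟩ <;> rfl
  | side k b i u =>
    simp only [children, Finset.mem_image] at hc
    obtain ⟨j, -, rfl⟩ := hc
    exact Vertex.parent_side_concat k b i u j

lemma mem_spineTree_of_mem_children (v : Vertex) (hv : v ∈ spineTree N) (c : Vertex)
    (hc : c ∈ children N v) : c ∈ spineTree N := by
  cases v with
  | spine k =>
    simp only [children, Finset.mem_insert, Finset.mem_union, Finset.mem_image,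
      Finset.mem_range] at hc
    rcases hc with rfl | ⟨i, hi, rfl⟩ | ⟨i, hi, rfl⟩
    · exact spine_mem_spineTree N _
    · exact (side_nil_mem_spineTree_iff N _ _ _).2 hi
    · exact (side_nil_mem_spineTree_iff N _ _ _).2 hi
  | side k b i u =>
    simp only [children, Finset.mem_image, Finset.mem_range] at hc
    obtain ⟨j, hj, rfl⟩ := hc
    exact (side_concat_mem_spineTree_iff N _ _ _ _ _).2 ⟨hv, hj⟩

lemma Vertex.cases_concat (c : Vertex) : (∃ k, c = .spine k) ∨ (∃ k b i, c = .side k b i []) ∨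
    ∃ k b i u j, c = .side k b i (u ++ [j]) := by
  cases c with
  | spine k => exact .inl ⟨k, rfl⟩
  | side k b i u =>
    rcases List.eq_nil_or_concat u with rfl | ⟨u, j, rfl⟩
    · exact .inr (.inl ⟨k, b, i, rfl⟩)
    · exact .inr (.inr ⟨k, b, i, u, j, by simp⟩)

lemma mem_children_of_parent_eq (v : Vertex) (c : Vertex) (hc : c ∈ spineTree N)
    (h : c.parent = some v) : c ∈ children N v := by
  rcases c.cases_concat with ⟨k, rfl⟩ | ⟨k, b, i, rfl⟩ | ⟨k, b, i, u, j, rfl⟩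
  · cases k with
    | zero => cases h
    | succ k =>
      cases h
      simp [children]
  · cases h
    rw [side_nil_mem_spineTree_iff] at hc
    cases b <;> simpa [children] using hc
  · rw [Vertex.parent_side_concat] at h
    cases h
    rw [side_concat_mem_spineTree_iff] at hc
    simpa [children] using hc.2

lemma mem_spineTree_of_parent_eq (c : Vertex) (hc : c ∈ spineTree N) (v : Vertex)
    (h : c.parent = some v) : v ∈ spineTree N := by
  rcases c.cases_concat with ⟨k, rfl⟩ | ⟨k, b, i, rfl⟩ | ⟨k, b, i, u, j, rfl⟩
  · cases k with
    | zero => cases h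
    | succ k => cases h; exact spine_mem_spineTree N _
  · cases h
    exact spine_mem_spineTree N _
  · rw [Vertex.parent_side_concat] at h
    cases h
    exact ((side_concat_mem_spineTree_iff N _ _ _ _ _).1 hc).1

/-- All cars can park on `spineTree N` if and only if the root is visited by at most one car,
however far from the root the tree is cut. -/
theorem allCarsPark_spineTree_iff :
    AllCarsPark Vertex.parent (carsOn (spineTree N) P) ↔
      ∀ h, visits (children N) P h (.spine 0) ≤ 1 := by
  classical
  rw [allCarsPark_iff, ← forall_sum_le_card_iff_visits_le_one P Vertex.depth
    Vertex.depth_of_parent (spine_mem_spineTree N 0) Vertex.parent_eq_none_iff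
    (parent_eq_of_mem_children N) (mem_spineTree_of_mem_children N) (mem_children_of_parent_eq N)]
  constructor
  · intro h S hST hS
    rw [← Finset.sum_congr rfl fun v hv => if_pos (hST hv)]
    exact h S hS
  · intro h S hS
    have h1 : ∑ v ∈ S, carsOn (spineTree N) P v = ∑ v ∈ S with v ∈ spineTree N, P v := by
      rw [Finset.sum_filter]
      rfl
    rw [h1]
    -- Vertices outside the tree receive no cars, and the part of `S` inside the tree is still
    -- closed under parents.
    refine (h _ (fun v hv => (Finset.mem_filter.1 hv).2) ?_).trans
      (Finset.card_le_card (Finset.filter_subset _ _))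
    intro v hv u hu
    rw [Finset.coe_filter] at hv ⊢
    exact ⟨hS v hv.1 u hu, mem_spineTree_of_parent_eq N v hv.2 u hu⟩

end Tree

/-! ### Limits of the generating functions: the quadratic equation and its two branches. -/

section Analysis

open Filter Topology Set

/-- Let t tend to 0. This extracts the leading coefficient from an inequality already divided by a
power of t. -/
lemma nonneg_of_forall_mul_le {C K : ℝ} {δ : ℝ} (hδ : 0 < δ)
    (h : ∀ t, 0 < t → t < δ → t * C ≤ K) : 0 ≤ K := by
  have hlim : Tendsto (fun t : ℝ => t * C) (𝓝[>] 0) (𝓝 0) := by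
    have : Tendsto (fun t : ℝ => t * C) (𝓝 0) (𝓝 (0 * C)) := tendsto_id.mul_const C
    rw [zero_mul] at this
    exact this.mono_left nhdsWithin_le_nhds
  refine le_of_tendsto hlim ?_
  filter_upwards [Ioo_mem_nhdsGT hδ] with t ht using h t ht.1 ht.2

/-- The discriminant `(2 - t (1 + α))² - 4 (1 - t) e^{-α t}` of the quadratic equation for the
generating function vanishes to second order at `t = 0`. -/
lemma abs_discrim_sub_le {α t : ℝ} (hα : 0 ≤ α) (ht : 0 ≤ t) (ht1 : t ≤ 1) (hαt : α * t ≤ 1) :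
    |(2 - t * (1 + α)) ^ 2 - 4 * ((1 - t) * Real.exp (-(α * t))) -
      (1 - 2 * α - α ^ 2) * t ^ 2| ≤ (2 * α ^ 2 + 4 * α ^ 3) * t ^ 3 := by
  have hx : |-(α * t)| ≤ 1 := by rwa [abs_neg, abs_of_nonneg (by positivity)]
  -- With the quadratic Taylor polynomial in place of the exponential, the discriminant has cubic
  -- term exactly 2α²t³; the Taylor remainder contributes at most 4α³t³.
  have h := Real.exp_bound hx (n := 3) (by norm_num)
  simp only [Finset.sum_range_succ, Finset.sum_range_zero, abs_neg,
    abs_of_nonneg (mul_nonneg hα ht)] at h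
  norm_num [Nat.factorial] at h
  set e := Real.exp (-(α * t))
  have h3 : 0 ≤ (α * t) ^ 3 := by positivity
  rw [abs_le] at h ⊢
  have h1 : 0 ≤ 1 - t := by linarith
  have h4 : (α * t) ^ 3 = α ^ 3 * t ^ 3 := by ring
  have h5 : 0 ≤ α ^ 2 * t ^ 3 := by positivity
  have h6 := mul_le_mul_of_nonneg_left h.1 h1
  have h7 := mul_le_mul_of_nonneg_left h.2 h1
  have h8 : 0 ≤ t * (α * t) ^ 3 := by positivity
  constructor <;> nlinarith

/-- The square increases with p, so p = 1 - α is the worst case, and e^{-αt} ≤ 1/(1 + αt + (αt)²/2)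
reduces the claim to a polynomial with nonnegative coefficients. At the critical α the t²
coefficient vanishes and the higher ones keep it positive. -/
lemma discrim_pos {α p t : ℝ} (hα : 0 ≤ α) (hαc : 2 * α + α ^ 2 ≤ 1) (hp : 1 - α ≤ p)
    (ht : 0 < t) (ht1 : t ≤ 1) :
    0 < (2 - t * (2 - p)) ^ 2 - 4 * ((1 - t) * Real.exp (-(α * t))) := by
  have hα1 : α < 1 := by nlinarith
  have he : Real.exp (-(α * t)) * (1 + α * t + (α * t) ^ 2 / 2) ≤ 1 := by
    rw [Real.exp_neg]
    have := Real.quadratic_le_exp_of_nonneg (mul_nonneg hα ht.le)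
    calc _ ≤ (Real.exp (α * t))⁻¹ * Real.exp (α * t) := by gcongr
      _ = 1 := inv_mul_cancel₀ (Real.exp_ne_zero _)
  set e := Real.exp (-(α * t))
  have hE : 0 < 1 + α * t + (α * t) ^ 2 / 2 := by positivity
  have hb : 0 < 2 - t * (1 + α) := by nlinarith
  have hmono : (2 - t * (1 + α)) ^ 2 ≤ (2 - t * (2 - p)) ^ 2 := by
    apply pow_le_pow_left₀ hb.le
    nlinarith
  have hkey : 0 < (2 - t * (1 + α)) ^ 2 * (1 + α * t + (α * t) ^ 2 / 2) - 4 * (1 - t) := by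
    have heq : (2 - t * (1 + α)) ^ 2 * (1 + α * t + (α * t) ^ 2 / 2) - 4 * (1 - t) =
      t ^ 2 * (1 - 2 * α - α ^ 2) + t ^ 3 * (α * (1 + α) * (1 - α)) +
        t ^ 4 * ((1 + α) ^ 2 * α ^ 2 / 2) := by ring
    rw [heq]
    have h1 : 0 ≤ t ^ 2 * (1 - 2 * α - α ^ 2) := mul_nonneg (by positivity) (by linarith)
    have h2 : 0 ≤ t ^ 3 * (α * (1 + α) * (1 - α)) :=
      mul_nonneg (by positivity) (mul_nonneg (by positivity) (by linarith))
    rcases hα.eq_or_lt with rfl | hα0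
    · have : 0 < t ^ 2 := by positivity
      norm_num
      positivity
    · have : 0 < t ^ 4 * ((1 + α) ^ 2 * α ^ 2 / 2) := by positivity
      linarith
  have h2 : (1 - t) * (e * (1 + α * t + (α * t) ^ 2 / 2)) ≤ 1 - t :=
    mul_le_of_le_one_right (by linarith) he
  have h3 : 0 < ((2 - t * (1 + α)) ^ 2 - 4 * ((1 - t) * e)) * (1 + α * t + (α * t) ^ 2 / 2) := by
    nlinarith
  have h4 := (pos_iff_pos_of_mul_pos h3).2 hE
  linarith

/-- The map x ↦ x(b - x) decreases beyond b/2, so b/2 ≤ g ≤ 1 gives b - 1 ≤ (1 - t)e^{-αt}.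
Comparing first order terms in t gives the bound on p. -/
lemma le_of_two_mul_ge {α p : ℝ} {g : ℝ → ℝ} (hα : 0 ≤ α)
    (hg1 : ∀ t, 0 < t → t < 1 → g t ≤ 1) (hb : ∀ t, 0 < t → t < 1 → 2 - t * (2 - p) ≤ 2 * g t)
    (hg : ∀ t, 0 < t → t < 1 → g t * (2 - t * (2 - p) - g t) = (1 - t) * Real.exp (-(α * t))) :
    p ≤ 1 - α := by
  have : 0 ≤ 1 - α - p := by
    refine nonneg_of_forall_mul_le (C := -(α * (2 - p))) one_pos fun t ht ht1 => ?_
    have h1 := hg1 t ht ht1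
    have h2 := hb t ht ht1
    have h3 := hg t ht ht1
    have h4 : 1 - t * (2 - p) ≤ (1 - t) * Real.exp (-(α * t)) := by nlinarith
    have h5 : Real.exp (-(α * t)) * (1 + α * t) ≤ 1 := by
      rw [Real.exp_neg]
      have := Real.add_one_le_exp (α * t)
      calc _ ≤ (Real.exp (α * t))⁻¹ * Real.exp (α * t) := by gcongr; linarith
        _ = 1 := inv_mul_cancel₀ (Real.exp_ne_zero _)
    have h6 : (1 - t * (2 - p)) * (1 + α * t) ≤ 1 - t :=
      calc _ ≤ (1 - t) * Real.exp (-(α * t)) * (1 + α * t) := by gcongr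
        _ = (1 - t) * (Real.exp (-(α * t)) * (1 + α * t)) := by ring
        _ ≤ _ := mul_le_of_le_one_right (by linarith) h5
    have h7 : t * (t * -(α * (2 - p))) ≤ t * (1 - α - p) := by nlinarith
    exact le_of_mul_le_mul_left h7 ht
  linarith

/-- The analytic properties of the generating functions `G h` of the number of visits to the root
of a grafted tree that is cut at height `h`, `F h` of the number of cars leaving it, `Y n` of the
number of visits to the first vertex of the path that do not come along the path, and `W n` of the
number of visits to the first vertex of the path, when the tree is cut at height `n`. -/
structure GenFunSystem (α : ℝ) (G F Y W : ℕ → ℝ → ℝ) : Prop where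
  G_nonneg : ∀ h, ∀ s ∈ Icc (0 : ℝ) 1, 0 ≤ G h s
  G_le_one : ∀ h, ∀ s ∈ Icc (0 : ℝ) 1, G h s ≤ 1
  G_anti : ∀ h, ∀ s ∈ Icc (0 : ℝ) 1, G (h + 1) s ≤ G h s
  G_lip : ∀ h, ∀ r ∈ Ico (0 : ℝ) 1, ∀ s ∈ Icc 0 r, ∀ s' ∈ Icc 0 r,
    |G h s - G h s'| ≤ (1 - r)⁻¹ * |s - s'|
  F_nonneg : ∀ h, ∀ s ∈ Icc (0 : ℝ) 1, 0 ≤ F h s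
  F_le_one : ∀ h, ∀ s ∈ Icc (0 : ℝ) 1, F h s ≤ 1
  G_succ : ∀ h, ∀ s ∈ Icc (0 : ℝ) 1, G (h + 1) s * (2 - F h s) = Real.exp (-(α * (1 - s)))
  mul_F : ∀ h, ∀ s ∈ Icc (0 : ℝ) 1, s * F h s = G h s - (1 - s) * G h 0
  Y_eq : ∀ n, ∀ s ∈ Icc (0 : ℝ) 1, Y n s = G (n + 1) s ^ 2 * Real.exp (α * (1 - s))
  Y_le_one : ∀ n, ∀ s ∈ Icc (0 : ℝ) 1, Y n s ≤ 1
  W_nonneg : ∀ n, ∀ s ∈ Icc (0 : ℝ) 1, 0 ≤ W n s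
  W_le_one : ∀ n, ∀ s ∈ Icc (0 : ℝ) 1, W n s ≤ 1
  W_anti : ∀ n, ∀ s ∈ Icc (0 : ℝ) 1, W (n + 1) s ≤ W n s
  W_tendsto : ∀ n, Tendsto (W n) (𝓝[<] 1) (𝓝 1)
  mul_W_succ : ∀ n, ∀ s ∈ Icc (0 : ℝ) 1, s * W (n + 1) s = Y n s * (W n s - (1 - s) * W n 0)

namespace GenFunSystem

variable {α : ℝ} {G F Y W : ℕ → ℝ → ℝ}

lemma tendsto_ciInf_of_anti {f : ℕ → ℝ} (h : ∀ n, f (n + 1) ≤ f n) (h0 : ∀ n, 0 ≤ f n) :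
    Tendsto f atTop (𝓝 (⨅ n, f n)) :=
  tendsto_atTop_ciInf (antitone_nat_of_succ_le h) ⟨0, by rintro _ ⟨n, rfl⟩; exact h0 n⟩

/-- Monotonicity in the height turns the recursion into s e^{-αt} ≤ g(b - g) ≤ b²/4 at finite
height; the first order terms at t = 0 give the bound. -/
lemma one_sub_le (S : GenFunSystem α G F Y W) (h : ℕ) : 1 - α ≤ G h 0 := by
  have : 0 ≤ 4 * (G h 0 - (1 - α)) := by
    refine nonneg_of_forall_mul_le (C := 4 * α - (2 - G h 0) ^ 2) one_pos fun t ht ht1 => ?_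
    have hs : 1 - t ∈ Icc (0 : ℝ) 1 := ⟨by linarith, by linarith⟩
    have h1 := S.G_anti h _ hs
    have h2 := S.F_le_one h _ hs
    have h3 := S.G_succ h _ hs
    have h4 := S.mul_F h _ hs
    have h5 := Real.one_sub_le_exp_neg (α * (1 - (1 - t)))
    rw [sub_sub_cancel] at h3 h4 h5
    set g := G h (1 - t)
    set f := F h (1 - t)
    set p := G h 0
    have h6 : Real.exp (-(α * t)) ≤ g * (2 - f) := by
      rw [← h3]
      exact mul_le_mul_of_nonneg_right h1 (by linarith)
    have h7 : (1 - t) * (1 - α * t) ≤ g * (2 * (1 - t) - (g - t * p)) := by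
      rw [← h4]
      calc _ ≤ (1 - t) * (g * (2 - f)) := mul_le_mul_of_nonneg_left (h5.trans h6) hs.1
        _ = _ := by ring
    have h8 : t * (t * (4 * α - (2 - p) ^ 2)) ≤ t * (4 * (p - (1 - α))) := by
      nlinarith [sq_nonneg (2 * g - (2 * (1 - t) + t * p))]
    exact le_of_mul_le_mul_left h8 ht
  linarith

lemma exp_neg_le (S : GenFunSystem α G F Y W) (h : ℕ) : Real.exp (-α) / 2 ≤ G (h + 1) 0 := by
  have h0 : (0 : ℝ) ∈ Icc (0 : ℝ) 1 := ⟨le_rfl, zero_le_one⟩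
  have h1 := S.G_succ h 0 h0
  have h2 := S.F_nonneg h 0 h0
  have h3 := S.G_nonneg (h + 1) 0 h0
  rw [sub_zero, mul_one] at h1
  rw [← h1]
  nlinarith

lemma tendsto_G (S : GenFunSystem α G F Y W) {s : ℝ} (hs : s ∈ Icc (0 : ℝ) 1) :
    Tendsto (fun h => G h s) atTop (𝓝 (⨅ h, G h s)) :=
  tendsto_ciInf_of_anti (fun h => S.G_anti h s hs) fun h => S.G_nonneg h s hs

lemma tendsto_W (S : GenFunSystem α G F Y W) {s : ℝ} (hs : s ∈ Icc (0 : ℝ) 1) :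
    Tendsto (fun n => W n s) atTop (𝓝 (⨅ n, W n s)) :=
  tendsto_ciInf_of_anti (fun h => S.W_anti h s hs) fun h => S.W_nonneg h s hs

lemma ciInf_G_le (S : GenFunSystem α G F Y W) {s : ℝ} (hs : s ∈ Icc (0 : ℝ) 1) (h : ℕ) :
    ⨅ h, G h s ≤ G h s :=
  ciInf_le ⟨0, by rintro _ ⟨n, rfl⟩; exact S.G_nonneg n s hs⟩ h

lemma ciInf_G_mul (S : GenFunSystem α G F Y W) {s : ℝ} (hs : s ∈ Icc (0 : ℝ) 1) :
    (⨅ h, G h s) * (2 * s + (1 - s) * (⨅ h, G h 0) - ⨅ h, G h s) =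
      s * Real.exp (-(α * (1 - s))) := by
  have h0 : (0 : ℝ) ∈ Icc (0 : ℝ) 1 := ⟨le_rfl, zero_le_one⟩
  have h1 : Tendsto (fun h => G (h + 1) s * (2 * s + (1 - s) * G h 0 - G h s)) atTop
      (𝓝 ((⨅ h, G h s) * (2 * s + (1 - s) * (⨅ h, G h 0) - ⨅ h, G h s))) :=
    ((tendsto_add_atTop_iff_nat 1).2 (S.tendsto_G hs)).mul
      ((tendsto_const_nhds.add ((S.tendsto_G h0).const_mul _)).sub (S.tendsto_G hs))
  refine tendsto_nhds_unique h1 (tendsto_const_nhds.congr fun h => ?_)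
  rw [← S.G_succ h s hs]
  linear_combination -G (h + 1) s * S.mul_F h s hs

lemma mul_ciInf_W (S : GenFunSystem α G F Y W) {s : ℝ} (hs : s ∈ Icc (0 : ℝ) 1) :
    s * (⨅ n, W n s) = (⨅ h, G h s) ^ 2 * Real.exp (α * (1 - s)) *
      ((⨅ n, W n s) - (1 - s) * ⨅ n, W n 0) := by
  have h0 : (0 : ℝ) ∈ Icc (0 : ℝ) 1 := ⟨le_rfl, zero_le_one⟩
  have h1 := ((tendsto_add_atTop_iff_nat 1).2 (S.tendsto_W hs)).const_mul s
  have h2 := ((((tendsto_add_atTop_iff_nat 1).2 (S.tendsto_G hs)).pow 2).mul_const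
    (Real.exp (α * (1 - s)))).mul ((S.tendsto_W hs).sub ((S.tendsto_W h0).const_mul (1 - s)))
  refine tendsto_nhds_unique h1 (h2.congr fun n => ?_)
  rw [S.mul_W_succ n s hs, S.Y_eq n s hs]

/-- The limit of the `Y n`, in terms of the limit `g` of the `G h`. -/
lemma sq_mul_exp_mul {g b s e : ℝ} (h : g * (b - g) = s * Real.exp (-e)) :
    g ^ 2 * Real.exp e * (b - g) = g * s := by
  calc _ = g * (g * (b - g)) * Real.exp e := by ring
    _ = g * s * (Real.exp (-e) * Real.exp e) := by rw [h]; ring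
    _ = _ := by rw [← Real.exp_add]; simp

lemma ciInf_W_nonneg (S : GenFunSystem α G F Y W) {s : ℝ} (hs : s ∈ Icc (0 : ℝ) 1) :
    0 ≤ ⨅ n, W n s := le_ciInf fun n => S.W_nonneg n s hs

/-- In the supercritical case the path is asymptotically never free of visits. -/
theorem ciInf_W_eq_zero (hα : 0 ≤ α) (hαc : 1 < 2 * α + α ^ 2) (S : GenFunSystem α G F Y W) :
    ⨅ n, W n 0 = 0 := by
  have h0 : (0 : ℝ) ∈ Icc (0 : ℝ) 1 := ⟨le_rfl, zero_le_one⟩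
  set p := ⨅ h, G h 0 with hp
  have hp1 : 1 - α ≤ p := le_ciInf fun h => S.one_sub_le h
  have hquad : ∀ t, 0 < t → t < 1 → (⨅ h, G h (1 - t)) * (2 - t * (2 - p) - ⨅ h, G h (1 - t)) =
      (1 - t) * Real.exp (-(α * t)) := by
    intro t ht ht1
    have := S.ciInf_G_mul (s := 1 - t) ⟨by linarith, by linarith⟩
    rw [sub_sub_cancel] at this
    rw [← this]
    ring
  -- If g were the larger root for every t, then p = 1 - α, and the discriminant would be negative
  -- for small t.
  obtain ⟨t, ht, ht1, hlt⟩ : ∃ t, 0 < t ∧ t < 1 ∧ 2 * (⨅ h, G h (1 - t)) < 2 - t * (2 - p) := by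
    by_contra! hcon
    have hp2 : p ≤ 1 - α := by
      refine le_of_two_mul_ge hα (fun t ht ht1 => ?_) hcon hquad
      have hs : 1 - t ∈ Icc (0 : ℝ) 1 := ⟨by linarith, by linarith⟩
      exact (S.ciInf_G_le hs 0).trans (S.G_le_one 0 _ hs)
    have hpeq : p = 1 - α := le_antisymm hp2 hp1
    have : 0 ≤ 1 - 2 * α - α ^ 2 := by
      -- The bound (α + 1)⁻¹ ensures αt ≤ 1, as the exponential estimate requires.
      refine nonneg_of_forall_mul_le (δ := min 1 (α + 1)⁻¹) (C := -(2 * α ^ 2 + 4 * α ^ 3))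
        (by positivity) fun t ht htd => ?_
      have ht1 : t < 1 := htd.trans_le (min_le_left _ _)
      have ht2 : t < (α + 1)⁻¹ := htd.trans_le (min_le_right _ _)
      have hαt : α * t ≤ 1 := by
        have : t * (α + 1) < 1 := (lt_inv_mul_iff₀' (by positivity)).1 (by simpa using ht2)
        nlinarith
      have h1 := (abs_le.1 (abs_discrim_sub_le hα ht.le ht1.le hαt)).2
      have h2 := hquad t ht ht1
      rw [hpeq] at h2
      have h3 : 0 ≤ (2 - t * (1 + α)) ^ 2 - 4 * ((1 - t) * Real.exp (-(α * t))) := by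
        rw [← h2]
        nlinarith [sq_nonneg (2 * (⨅ h, G h (1 - t)) - (2 - t * (1 + α)))]
      have h4 : t ^ 2 * (t * -(2 * α ^ 2 + 4 * α ^ 3)) ≤ t ^ 2 * (1 - 2 * α - α ^ 2) := by
        nlinarith
      exact le_of_mul_le_mul_left h4 (by positivity)
    linarith
  have hs : 1 - t ∈ Icc (0 : ℝ) 1 := ⟨by linarith, by linarith⟩
  have h1 := hquad t ht ht1
  have h2 := S.mul_ciInf_W hs
  rw [sub_sub_cancel] at h2
  have h3 := sq_mul_exp_mul h1
  have hpos : 0 < (1 - t) * Real.exp (-(α * t)) := mul_pos (by linarith) (Real.exp_pos _)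
  have hq := S.ciInf_W_nonneg h0
  have hw := S.ciInf_W_nonneg hs
  have hg0 : 0 ≤ ⨅ h, G h (1 - t) := le_ciInf fun h => S.G_nonneg h _ hs
  set g := ⨅ h, G h (1 - t)
  set w := ⨅ n, W n (1 - t)
  set q := ⨅ n, W n 0
  set y := g ^ 2 * Real.exp (α * t)
  have hg : 0 < g := hg0.lt_of_ne (by rintro h; rw [← h] at h1; simp at h1; linarith)
  have hbg : 0 < 2 - t * (2 - p) - g := by linarith
  have hy : 0 < y := by positivity
  have hys : y < 1 - t := by
    have : y * (2 - t * (2 - p) - g) < (1 - t) * (2 - t * (2 - p) - g) := by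
      rw [h3, mul_comm]
      exact mul_lt_mul_of_pos_left (by linarith) (by linarith)
    exact lt_of_mul_lt_mul_right this hbg.le
  -- The path equation reads y t q = (y - s)w, with y < s and w ≥ 0.
  have h5 : y * t * q ≤ 0 := by nlinarith
  have h6 : q ≤ 0 := by
    by_contra! hq'
    have : 0 < y * t * q := by positivity
    linarith
  exact le_antisymm h6 hq

/-- At s = 0 the difference 2g - b equals p > 0. A sign change would produce a zero, hence a zero of
the discriminant, which `discrim_pos` excludes. Continuity of the limit comes from the uniform
Lipschitz bound. -/
lemma two_mul_gt (hα : 0 ≤ α) (hαc : 2 * α + α ^ 2 ≤ 1) (S : GenFunSystem α G F Y W) {s : ℝ}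
    (hs : s ∈ Ico (0 : ℝ) 1) : 2 * s + (1 - s) * (⨅ h, G h 0) < 2 * ⨅ h, G h s := by
  have h0 : (0 : ℝ) ∈ Icc (0 : ℝ) 1 := ⟨le_rfl, zero_le_one⟩
  have hp1 : 1 - α ≤ ⨅ h, G h 0 := le_ciInf fun h => S.one_sub_le h
  have hα1 : α < 1 := by nlinarith
  by_contra! hle
  have hcont : ContinuousOn (fun x => 2 * (⨅ h, G h x) - (2 * x + (1 - x) * (⨅ h, G h 0)))
      (Icc 0 s) := by
    refine ContinuousOn.sub (ContinuousOn.mul continuousOn_const ?_) (by fun_prop)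
    refine (LipschitzOnWith.of_dist_le_mul (K := (1 - s)⁻¹.toNNReal)
      fun x hx y hy => ?_).continuousOn
    rw [Real.dist_eq, Real.dist_eq, Real.coe_toNNReal _ (inv_nonneg.2 (by linarith [hs.2]))]
    have hx' : x ∈ Icc (0 : ℝ) 1 := ⟨hx.1, hx.2.trans hs.2.le⟩
    have hy' : y ∈ Icc (0 : ℝ) 1 := ⟨hy.1, hy.2.trans hs.2.le⟩
    exact le_of_tendsto ((S.tendsto_G hx').sub (S.tendsto_G hy')).abs
      (Eventually.of_forall fun h => S.G_lip h s hs x hx y hy)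
  obtain ⟨x, hx, hx0⟩ := intermediate_value_Icc' hs.1 hcont
    (show (0 : ℝ) ∈ _ from ⟨by linarith, by simp; linarith⟩)
  have hx1 : x < 1 := hx.2.trans_lt hs.2
  have hD := discrim_pos hα hαc hp1 (t := 1 - x) (by linarith) (by linarith [hx.1])
  have hq := S.ciInf_G_mul (s := x) ⟨hx.1, hx1.le⟩
  rw [sub_sub_cancel, ← hq] at hD
  simp only at hx0
  nlinarith

theorem ciInf_G_eq (hα : 0 ≤ α) (hαc : 2 * α + α ^ 2 ≤ 1) (S : GenFunSystem α G F Y W) :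
    ⨅ h, G h 0 = 1 - α := by
  refine le_antisymm ?_ (le_ciInf fun h => S.one_sub_le h)
  refine le_of_two_mul_ge (g := fun t => ⨅ h, G h (1 - t)) hα (fun t ht ht1 => ?_)
    (fun t ht ht1 => ?_) fun t ht ht1 => ?_
  · have hs : 1 - t ∈ Icc (0 : ℝ) 1 := ⟨by linarith, by linarith⟩
    exact (S.ciInf_G_le hs 0).trans (S.G_le_one 0 _ hs)
  · have := S.two_mul_gt hα hαc (s := 1 - t) ⟨by linarith, by linarith⟩
    rw [sub_sub_cancel] at this
    linarith
  · have := S.ciInf_G_mul (s := 1 - t) ⟨by linarith, by linarith⟩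
    rw [sub_sub_cancel] at this
    rw [← this]
    ring

lemma tendsto_discrim (hα : 0 ≤ α) :
    Tendsto (fun s : ℝ => ((2 - (1 - s) * (1 + α)) ^ 2 -
      4 * (s * Real.exp (-(α * (1 - s))))) / (1 - s) ^ 2) (𝓝[<] 1) (𝓝 (1 - 2 * α - α ^ 2)) := by
  rw [tendsto_iff_dist_tendsto_zero]
  have hlim : Tendsto (fun s : ℝ => (2 * α ^ 2 + 4 * α ^ 3) * (1 - s)) (𝓝[<] 1) (𝓝 0) := by
    have : Continuous fun s : ℝ => (2 * α ^ 2 + 4 * α ^ 3) * (1 - s) := by fun_prop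
    simpa using (this.tendsto 1).mono_left nhdsWithin_le_nhds
  refine squeeze_zero' (Eventually.of_forall fun _ => dist_nonneg) ?_ hlim
  have hδ : max 0 (1 - (α + 1)⁻¹) < 1 := max_lt one_pos (by simp; positivity)
  filter_upwards [Ioo_mem_nhdsLT hδ] with s hs
  have hs0 : 0 < s := (le_max_left _ _).trans_lt hs.1
  have hs1 : 1 - s < (α + 1)⁻¹ := by linarith [(le_max_right 0 (1 - (α + 1)⁻¹)).trans_lt hs.1]
  have ht : 0 < 1 - s := by linarith [hs.2]
  have hαt : α * (1 - s) ≤ 1 := by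
    have : (1 - s) * (α + 1) < 1 := (lt_inv_mul_iff₀' (by positivity)).1 (by simpa using hs1)
    nlinarith
  have h := abs_discrim_sub_le hα ht.le (by linarith) hαt
  rw [sub_sub_cancel] at h
  rw [Real.dist_eq, div_sub' (by positivity), abs_div, abs_of_nonneg (sq_nonneg (1 - s)),
    div_le_iff₀ (by positivity)]
  calc _ = _ := by rw [mul_comm ((1 - s) ^ 2)]
    _ ≤ _ := h
    _ = _ := by ring

/-- In the subcritical and critical cases, the asymptotic probability that the first vertex of the
path is not visited. -/
theorem ciInf_W_eq (hα : 0 ≤ α) (hαc : 2 * α + α ^ 2 ≤ 1) (S : GenFunSystem α G F Y W) :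
    ⨅ n, W n 0 = √(1 - 2 * α - α ^ 2) := by
  have h0 : (0 : ℝ) ∈ Icc (0 : ℝ) 1 := ⟨le_rfl, zero_le_one⟩
  have hp := S.ciInf_G_eq hα hαc
  set q := ⨅ n, W n 0 with hq
  set R := √(1 - 2 * α - α ^ 2) with hR
  set g : ℝ → ℝ := fun s => ⨅ h, G h s with hg
  set b : ℝ → ℝ := fun s => 2 - (1 - s) * (1 + α) with hb
  set y : ℝ → ℝ := fun s => g s ^ 2 * Real.exp (α * (1 - s)) with hy
  have hI : ∀ᶠ s in 𝓝[<] (1 : ℝ), s ∈ Ioo (0 : ℝ) 1 := Ioo_mem_nhdsLT one_pos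
  have hquad : ∀ s ∈ Ioo (0 : ℝ) 1, g s * (b s - g s) = s * Real.exp (-(α * (1 - s))) := by
    intro s hs
    have := S.ciInf_G_mul (s := s) ⟨hs.1.le, hs.2.le⟩
    rw [hp] at this
    rw [← this]
    ring
  have hupper : ∀ s ∈ Ioo (0 : ℝ) 1, b s < 2 * g s := by
    intro s hs
    have := S.two_mul_gt hα hαc (s := s) ⟨hs.1.le, hs.2⟩
    rw [hp] at this
    simp only [hb, hg]
    linarith
  -- On the larger branch 2g - b is the positive square root of the discriminant.
  have hroot : Tendsto (fun s => (2 * g s - b s) / (1 - s)) (𝓝[<] 1) (𝓝 R) := by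
    refine (tendsto_discrim hα).sqrt.congr' ?_
    filter_upwards [hI] with s hs
    have ht : 0 < 1 - s := by linarith [hs.2]
    rw [← hquad s hs, Real.sqrt_eq_iff_mul_self_eq_of_pos
      (div_pos (by linarith [hupper s hs]) ht)]
    simp only [hb]
    field_simp
    ring
  have hid : Tendsto (fun s : ℝ => s) (𝓝[<] 1) (𝓝 1) := tendsto_id.mono_left nhdsWithin_le_nhds
  have hb1 : Tendsto b (𝓝[<] 1) (𝓝 2) := by
    have : Continuous b := by fun_prop
    simpa [hb] using (this.tendsto 1).mono_left nhdsWithin_le_nhds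
  have hk : Tendsto (fun s => 2 * g s - b s) (𝓝[<] 1) (𝓝 0) := by
    have h1 : Tendsto (fun s => (2 * g s - b s) / (1 - s) * (1 - s)) (𝓝[<] 1)
        (𝓝 (R * (1 - 1))) := hroot.mul (tendsto_const_nhds.sub hid)
    rw [sub_self, mul_zero] at h1
    refine h1.congr' ?_
    filter_upwards [hI] with s hs
    rw [div_mul_cancel₀]
    linarith [hs.2]
  have hbg1 : Tendsto (fun s => b s - g s) (𝓝[<] 1) (𝓝 1) := by
    have h1 : Tendsto (fun s => (b s - (2 * g s - b s)) / 2) (𝓝[<] 1) (𝓝 ((2 - 0) / 2)) :=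
      (hb1.sub hk).div_const 2
    norm_num at h1
    exact h1.congr fun s => by ring
  have hbg : ∀ s ∈ Ioo (0 : ℝ) 1, 0 < b s - g s := by
    intro s hs
    have hs' : s ∈ Icc (0 : ℝ) 1 := ⟨hs.1.le, hs.2.le⟩
    have h1 : 0 ≤ g s := le_ciInf fun h => S.G_nonneg h _ hs'
    have h2 : 0 < g s * (b s - g s) := by
      rw [hquad s hs]
      exact mul_pos hs.1 (Real.exp_pos _)
    by_contra! hcon
    nlinarith
  have hys : ∀ s ∈ Ioo (0 : ℝ) 1, (y s - s) / (1 - s) =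
      s * ((2 * g s - b s) / (1 - s)) / (b s - g s) := by
    intro s hs
    have h1 := sq_mul_exp_mul (hquad s hs)
    change y s * (b s - g s) = g s * s at h1
    have h2 := (hbg s hs).ne'
    have ht : 1 - s ≠ 0 := by linarith [hs.2]
    field_simp
    linear_combination h1
  have hslope : Tendsto (fun s => (y s - s) / (1 - s)) (𝓝[<] 1) (𝓝 R) := by
    have h1 := (hid.mul hroot).div hbg1 one_ne_zero
    rw [one_mul, div_one] at h1
    refine h1.congr' ?_
    filter_upwards [hI] with s hs using (hys s hs).symm
  have hy1 : Tendsto y (𝓝[<] 1) (𝓝 1) := by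
    have h1 := hid.add ((tendsto_const_nhds (x := (1 : ℝ))).sub hid |>.mul hslope)
    rw [sub_self, zero_mul, add_zero] at h1
    refine h1.congr' ?_
    filter_upwards [hI] with s hs
    have ht : 1 - s ≠ 0 := by linarith [hs.2]
    field_simp
    ring
  have hyge : ∀ s ∈ Ioo (0 : ℝ) 1, 0 ≤ (y s - s) / (1 - s) := by
    intro s hs
    rw [hys s hs]
    have h1 := hupper s hs
    exact div_nonneg (mul_nonneg hs.1.le (div_nonneg (by linarith) (by linarith [hs.2])))
      (hbg s hs).le
  apply le_antisymm
  -- Upper bound: q y = w (y - s)/(1 - s) with w ≤ 1, and y tends to 1.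
  · have h1 : Tendsto (fun s => q * y s) (𝓝[<] 1) (𝓝 (q * 1)) := hy1.const_mul q
    rw [mul_one] at h1
    refine le_of_tendsto_of_tendsto h1 hslope ?_
    filter_upwards [hI] with s hs
    have hs' : s ∈ Icc (0 : ℝ) 1 := ⟨hs.1.le, hs.2.le⟩
    have ht : 0 < 1 - s := by linarith [hs.2]
    have h2 := S.mul_ciInf_W hs'
    change s * _ = y s * (_ - (1 - s) * q) at h2
    have h3 : ⨅ n, W n s ≤ 1 :=
      (ciInf_le ⟨0, by rintro _ ⟨n, rfl⟩; exact S.W_nonneg n s hs'⟩ 0).trans (S.W_le_one 0 s hs')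
    have h4 : q * y s = (⨅ n, W n s) * ((y s - s) / (1 - s)) := by
      field_simp
      linear_combination h2
    rw [h4]
    exact mul_le_of_le_one_left (hyge s hs) h3
  -- Lower bound, at finite `n`: `W n` tends to 1 as s → 1, which is not known beforehand for the
  -- limit w. The exact recursion becomes an inequality through `W (n + 1) ≤ W n` and `y ≤ Y n ≤ 1`.
  · refine le_ciInf fun n => ?_
    have h1 := (S.W_tendsto n).mul hslope
    rw [one_mul] at h1
    refine le_of_tendsto h1 ?_
    filter_upwards [hI] with s hs
    have hs' : s ∈ Icc (0 : ℝ) 1 := ⟨hs.1.le, hs.2.le⟩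
    have ht : 0 < 1 - s := by linarith [hs.2]
    have h2 := S.mul_W_succ n s hs'
    have h3 := S.W_anti n s hs'
    have h4 := S.Y_le_one n s hs'
    have h5 : y s ≤ Y n s := by
      rw [S.Y_eq n s hs']
      have := S.ciInf_G_le hs' (n + 1)
      have : 0 ≤ g s := le_ciInf fun h => S.G_nonneg h _ hs'
      simp only [hy]
      gcongr
    have h6 := S.W_nonneg n s hs'
    have h7 := S.W_nonneg n 0 h0
    rw [mul_div_assoc', div_le_iff₀ ht]
    calc W n s * (y s - s) ≤ W n s * (Y n s - s) := by gcongr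
      _ = Y n s * ((1 - s) * W n 0) + s * (W (n + 1) s - W n s) := by
        linear_combination -h2
      _ ≤ 1 * ((1 - s) * W n 0) + 0 := by
        gcongr
        nlinarith [hs.1]
      _ = _ := by ring

end GenFunSystem

end Analysis

/-! ### Probability generating functions. -/

section Pgf

open Set

variable {Ω : Type*} [MeasurableSpace Ω] (μ : Measure Ω)

/-- The probability generating function of a random variable with values in `ℕ`. -/
noncomputable def pgf (X : Ω → ℕ) (s : ℝ) : ℝ := ∫ ω, s ^ X ω ∂μ

variable {μ} {X X' : Ω → ℕ} {s : ℝ}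

lemma pgf_nonneg (hs : 0 ≤ s) : 0 ≤ pgf μ X s := integral_nonneg fun _ => pow_nonneg hs _

lemma pgf_zero (hX : Measurable X) : pgf μ X 0 = μ.real {ω | X ω = 0} := by
  have hm : MeasurableSet {ω | X ω = 0} := hX (measurableSet_singleton 0)
  rw [← integral_indicator_one hm, pgf]
  refine integral_congr_ae (.of_forall fun ω => ?_)
  simp [indicator_apply, zero_pow_eq]

lemma pgf_poisson {r : ℝ≥0} (h : HasLaw X (poissonMeasure r) μ) :
    pgf μ X s = Real.exp (-(r * (1 - s))) := by
  have h1 : pgf μ X s = ∫ n, s ^ n ∂poissonMeasure r := by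
    rw [← h.map_eq, integral_map h.aemeasurable (by fun_prop)]
    rfl
  rw [h1, integral_poissonMeasure]
  have h2 : ∀ n : ℕ, (Real.exp (-r) * (r : ℝ) ^ n / (n.factorial : ℝ)) • s ^ n =
      Real.exp (-r) * ((r * s) ^ n / (n.factorial : ℝ)) := by
    intro n
    rw [smul_eq_mul, mul_pow]
    ring
  simp_rw [h2]
  rw [tsum_mul_left, (NormedSpace.expSeries_div_hasSum_exp ((r : ℝ) * s)).tsum_eq,
    ← Real.exp_eq_exp_ℝ, ← Real.exp_add]
  ring_nf

variable [IsProbabilityMeasure μ]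

lemma integrable_pow (hX : Measurable X) (hs : s ∈ Icc (0 : ℝ) 1) :
    Integrable (fun ω => s ^ X ω) μ := by
  refine Integrable.of_bound (by fun_prop) 1 (.of_forall fun ω => ?_)
  rw [Real.norm_of_nonneg (pow_nonneg hs.1 _)]
  exact pow_le_one₀ hs.1 hs.2

lemma pgf_le_one (hX : Measurable X) (hs : s ∈ Icc (0 : ℝ) 1) : pgf μ X s ≤ 1 := by
  calc pgf μ X s ≤ ∫ _, 1 ∂μ := integral_mono (integrable_pow hX hs) (integrable_const _)
        fun ω => pow_le_one₀ hs.1 hs.2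
    _ = 1 := by simp

lemma pgf_anti (hX : Measurable X) (hX' : Measurable X') (h : ∀ ω, X ω ≤ X' ω)
    (hs : s ∈ Icc (0 : ℝ) 1) : pgf μ X' s ≤ pgf μ X s :=
  integral_mono (integrable_pow hX' hs) (integrable_pow hX hs)
    fun ω => pow_le_pow_of_le_one hs.1 hs.2 (h ω)

/-- The factor of s - s' is dominated by a geometric series, so the constant does not depend on `n`.
All generating functions thus share a Lipschitz constant on [0, r], which survives the limit. -/
lemma abs_pow_sub_pow_le {r s s' : ℝ} (hr : r ∈ Ico (0 : ℝ) 1) (hs : s ∈ Icc 0 r)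
    (hs' : s' ∈ Icc 0 r) (n : ℕ) : |s ^ n - s' ^ n| ≤ (1 - r)⁻¹ * |s - s'| := by
  rw [← (Commute.all s s').geom_sum₂_mul, abs_mul]
  refine mul_le_mul_of_nonneg_right ?_ (abs_nonneg _)
  calc |∑ i ∈ Finset.range n, s ^ i * s' ^ (n - 1 - i)|
      ≤ ∑ i ∈ Finset.range n, |s ^ i * s' ^ (n - 1 - i)| := Finset.abs_sum_le_sum_abs _ _
    _ ≤ ∑ i ∈ Finset.range n, r ^ i := by
        refine Finset.sum_le_sum fun i _ => ?_
        rw [abs_mul, abs_of_nonneg (pow_nonneg hs.1 _), abs_of_nonneg (pow_nonneg hs'.1 _)]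
        calc s ^ i * s' ^ (n - 1 - i) ≤ r ^ i * 1 :=
              mul_le_mul (pow_le_pow_left₀ hs.1 hs.2 _)
                (pow_le_one₀ hs'.1 (hs'.2.trans hr.2.le)) (pow_nonneg hs'.1 _)
                (pow_nonneg hr.1 _)
          _ = r ^ i := mul_one _
    _ ≤ ∑' i, r ^ i := (summable_geometric_of_lt_one hr.1 hr.2).sum_le_tsum _
        fun i _ => pow_nonneg hr.1 _
    _ = (1 - r)⁻¹ := tsum_geometric_of_lt_one hr.1 hr.2

lemma abs_pgf_sub_pgf_le (hX : Measurable X) {r s s' : ℝ} (hr : r ∈ Ico (0 : ℝ) 1)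
    (hs : s ∈ Icc 0 r) (hs' : s' ∈ Icc 0 r) :
    |pgf μ X s - pgf μ X s'| ≤ (1 - r)⁻¹ * |s - s'| := by
  rw [pgf, pgf, ← integral_sub (integrable_pow hX ⟨hs.1, hs.2.trans hr.2.le⟩)
    (integrable_pow hX ⟨hs'.1, hs'.2.trans hr.2.le⟩)]
  have := norm_integral_le_of_norm_le_const (μ := μ) (f := fun ω => s ^ X ω - s' ^ X ω)
    (.of_forall fun ω => abs_pow_sub_pow_le hr hs hs' (X ω))
  simpa using this

lemma continuousOn_pgf (hX : Measurable X) : ContinuousOn (pgf μ X) (Icc 0 1) := by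
  refine continuousOn_of_dominated (bound := fun _ => 1) (fun s _ => by fun_prop)
    (fun s hs => .of_forall fun ω => ?_) (integrable_const _) (.of_forall fun ω => by fun_prop)
  rw [Real.norm_of_nonneg (pow_nonneg hs.1 _)]
  exact pow_le_one₀ hs.1 hs.2

lemma tendsto_pgf_one (hX : Measurable X) :
    Filter.Tendsto (pgf μ X) (nhdsWithin 1 (Iio 1)) (nhds 1) := by
  have h : Filter.Tendsto (pgf μ X) (nhdsWithin 1 (Icc 0 1)) (nhds (pgf μ X 1)) :=
    continuousOn_pgf hX 1 ⟨zero_le_one, le_rfl⟩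
  have h1 : pgf μ X 1 = 1 := by simp [pgf]
  rw [h1] at h
  refine h.mono_left ?_
  rw [nhdsWithin_le_iff]
  filter_upwards [Ioo_mem_nhdsLT (zero_lt_one' ℝ)] with s hs using ⟨hs.1.le, hs.2.le⟩

lemma mul_pgf_pred (hX : Measurable X) (hs : s ∈ Icc (0 : ℝ) 1) :
    s * pgf μ (fun ω => X ω - 1) s = pgf μ X s - (1 - s) * pgf μ X 0 := by
  rw [pgf, pgf, pgf, ← integral_const_mul, ← integral_const_mul, ← integral_sub
    (integrable_pow hX hs) ((integrable_pow hX ⟨le_rfl, zero_le_one⟩).const_mul _)]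
  refine integral_congr_ae (.of_forall fun ω => ?_)
  simp only
  rcases h : X ω with _ | n
  · simp
  · simp [pow_succ']

/-- For s > 0 divide `mul_pgf_pred` by s; the value at 0 follows by continuity. -/
lemma pgf_pred_congr (hX : Measurable X) (hX' : Measurable X')
    (h : ∀ s ∈ Icc (0 : ℝ) 1, pgf μ X s = pgf μ X' s) (hs : s ∈ Icc (0 : ℝ) 1) :
    pgf μ (fun ω => X ω - 1) s = pgf μ (fun ω => X' ω - 1) s := by
  have h0 : (0 : ℝ) ∈ Icc (0 : ℝ) 1 := ⟨le_rfl, zero_le_one⟩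
  have hpos : EqOn (pgf μ (fun ω => X ω - 1)) (pgf μ (fun ω => X' ω - 1)) (Ioo 0 1) := by
    intro s hs
    have hs' : s ∈ Icc (0 : ℝ) 1 := ⟨hs.1.le, hs.2.le⟩
    apply mul_left_cancel₀ hs.1.ne'
    rw [mul_pgf_pred hX hs', mul_pgf_pred hX' hs', h s hs', h 0 h0]
  have hcl : Icc (0 : ℝ) 1 ⊆ closure (Ioo 0 1) := by rw [closure_Ioo zero_ne_one]
  exact hpos.of_subset_closure (continuousOn_pgf (by fun_prop)) (continuousOn_pgf (by fun_prop))
    Ioo_subset_Icc_self hcl hs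

end Pgf

/-! ### Independence over disjoint index sets, and products with a geometric number of factors. -/

section Independence

open Set

variable {Ω J : Type*} {ξ : J → Ω → ℕ}

/-- The σ-algebra generated by the random variables with indices in `S`. -/
@[reducible] def sigmaOf (ξ : J → Ω → ℕ) (S : Set J) : MeasurableSpace Ω :=
  ⨆ j ∈ S, MeasurableSpace.comap (ξ j) ⊤

lemma sigmaOf_mono (ξ : J → Ω → ℕ) {S T : Set J} (h : S ⊆ T) : sigmaOf ξ S ≤ sigmaOf ξ T :=
  biSup_mono h

lemma measurable_sigmaOf {S : Set J} {j : J} (hj : j ∈ S) : Measurable[sigmaOf ξ S] (ξ j) :=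
  Measurable.mono (comap_measurable (ξ j))
    (le_iSup₂ (f := fun j (_ : j ∈ S) => MeasurableSpace.comap (ξ j) ⊤) j hj) le_rfl

lemma measurable_nat_comp {Ω β : Type*} {m : MeasurableSpace Ω} {_ : MeasurableSpace β}
    {N : Ω → ℕ} {f : ℕ → Ω → β} (hN : Measurable N) (hf : ∀ n, Measurable (f n)) :
    Measurable fun ω => f (N ω) ω :=
  (measurable_from_prod_countable_right (f := fun p : ℕ × Ω => f p.1 p.2) hf).comp
    (hN.prodMk measurable_id)

variable [MeasurableSpace Ω] {μ : Measure Ω}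

lemma sigmaOf_le (hξ : ∀ j, Measurable (ξ j)) (S : Set J) :
    sigmaOf ξ S ≤ (inferInstance : MeasurableSpace Ω) :=
  iSup₂_le fun j _ => (hξ j).comap_le

lemma integral_mul_of_disjoint (hξ : ∀ j, Measurable (ξ j)) (hind : iIndepFun ξ μ)
    {S T : Set J} (hST : Disjoint S T) {f g : Ω → ℝ} (hf : Measurable[sigmaOf ξ S] f)
    (hg : Measurable[sigmaOf ξ T] g) :
    ∫ ω, f ω * g ω ∂μ = (∫ ω, f ω ∂μ) * ∫ ω, g ω ∂μ := by
  have h1 : Indep (sigmaOf ξ S) (sigmaOf ξ T) μ :=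
    indep_iSup_of_disjoint (fun j => (hξ j).comap_le) hind.iIndep hST
  have h2 : IndepFun f g μ := by
    rw [IndepFun_iff_Indep]
    exact indep_of_indep_of_le_left (indep_of_indep_of_le_right h1 hg.comap_le) hf.comap_le
  exact h2.integral_fun_mul_eq_mul_integral
    (hf.mono (sigmaOf_le hξ S) le_rfl).aestronglyMeasurable
    (hg.mono (sigmaOf_le hξ T) le_rfl).aestronglyMeasurable

variable [IsProbabilityMeasure μ]

lemma integral_prod_range (hξ : ∀ j, Measurable (ξ j)) (hind : iIndepFun ξ μ) {g : ℕ → Ω → ℝ}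
    {S : ℕ → Set J} (hS : Pairwise (Function.onFun Disjoint S))
    (hg : ∀ i, Measurable[sigmaOf ξ (S i)] (g i)) {a : ℝ} (ha : ∀ i, ∫ ω, g i ω ∂μ = a) (n : ℕ) :
    ∫ ω, ∏ i ∈ Finset.range n, g i ω ∂μ = a ^ n := by
  induction n with
  | zero => simp
  | succ n ih =>
    simp_rw [Finset.prod_range_succ]
    rw [integral_mul_of_disjoint hξ hind (S := ⋃ i ∈ Finset.range n, S i) (T := S n) _ _ (hg n),
      ih, ha, pow_succ]
    · simp only [Finset.mem_range, disjoint_iUnion_left]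
      exact fun i hi => hS hi.ne
    · exact Finset.measurable_fun_prod _ fun i hi =>
        (hg i).mono (sigmaOf_mono ξ (subset_biUnion_of_mem (u := S) hi)) le_rfl

/-- The mean of a product of a geometric number of factors. -/
lemma integral_prod_range_geometric (hξ : ∀ j, Measurable (ξ j)) (hind : iIndepFun ξ μ)
    {g : ℕ → Ω → ℝ} {S : ℕ → Set J} {j : J} (hlaw : HasLaw (ξ j) (geometricMeasure half) μ)
    (hS : Pairwise (Function.onFun Disjoint S)) (hj : ∀ i, j ∉ S i)
    (hg : ∀ i, Measurable[sigmaOf ξ (S i)] (g i)) (hg01 : ∀ i ω, g i ω ∈ Icc (0 : ℝ) 1)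
    {a : ℝ} (ha : ∀ i, ∫ ω, g i ω ∂μ = a) (ha01 : a ∈ Icc (0 : ℝ) 1) :
    ∫ ω, ∏ i ∈ Finset.range (ξ j ω), g i ω ∂μ = (2 - a)⁻¹ := by
  have hgm : ∀ i, Measurable (g i) := fun i => (hg i).mono (sigmaOf_le hξ (S i)) le_rfl
  have hm : Measurable fun ω => ∏ i ∈ Finset.range (ξ j ω), g i ω :=
    measurable_nat_comp (f := fun n ω => ∏ i ∈ Finset.range n, g i ω) (hξ j)
      fun n => Finset.measurable_fun_prod _ fun i _ => hgm i
  have hint : Integrable (fun ω => ∏ i ∈ Finset.range (ξ j ω), g i ω) μ := by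
    refine Integrable.of_bound hm.aestronglyMeasurable 1 (.of_forall fun ω => ?_)
    rw [Real.norm_of_nonneg (Finset.prod_nonneg fun i _ => (hg01 i ω).1)]
    exact Finset.prod_le_one (fun i _ => (hg01 i ω).1) fun i _ => (hg01 i ω).2
  have hms : ∀ n, MeasurableSet (ξ j ⁻¹' {n}) := fun n => hξ j (measurableSet_singleton n)
  have hsum := hasSum_integral_iUnion hms (fun m n hmn => by
    rw [Function.onFun, disjoint_left]
    rintro ω rfl h
    exact hmn h) hint.integrableOn
  have huniv : ⋃ n, ξ j ⁻¹' {n} = univ := by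
    ext ω
    simp
  rw [huniv, setIntegral_univ] at hsum
  refine hsum.unique ?_
  -- Conditioning on the number of factors leaves the geometric series ∑ 2^{-(n+1)} aⁿ = 1/(2 - a).
  have hterm : ∀ n, ∫ ω in ξ j ⁻¹' {n}, ∏ i ∈ Finset.range (ξ j ω), g i ω ∂μ =
      1 / 2 * (a / 2) ^ n := by
    intro n
    have h1 : ∫ ω in ξ j ⁻¹' {n}, ∏ i ∈ Finset.range (ξ j ω), g i ω ∂μ =
        ∫ ω, (ξ j ⁻¹' {n}).indicator 1 ω * ∏ i ∈ Finset.range n, g i ω ∂μ := by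
      rw [← integral_indicator (hms n)]
      refine integral_congr_ae (.of_forall fun ω => ?_)
      by_cases h : ξ j ω = n <;> simp [indicator, h]
    rw [h1, integral_mul_of_disjoint hξ hind (S := {j}) (T := ⋃ i, S i),
      integral_prod_range hξ hind hS hg ha, integral_indicator_one (hms n)]
    · have h2 := geometricMeasure_real_singleton (p := half) (fun h => by
        have : (half : ℝ) = 0 := by rw [h]; rfl
        norm_num [half] at this) n
      have h3 : μ.real (ξ j ⁻¹' {n}) = (geometricMeasure half).real {n} :=
        hlaw.measureReal_eq (p := fun m => m = n) (measurableSet_singleton n)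
      rw [h3, h2]
      simp only [half]
      rw [show (1 : ℝ) - 1 / 2 = 1 / 2 by norm_num, show a / 2 = 1 / 2 * a by ring, mul_pow]
      ring
    · simpa using hj
    · exact (measurable_const : Measurable[sigmaOf ξ {j}] fun _ => (1 : ℝ)).indicator
        (measurable_sigmaOf (mem_singleton j) (measurableSet_singleton n))
    · exact Finset.measurable_fun_prod _ fun i _ =>
        (hg i).mono (sigmaOf_mono ξ (subset_iUnion S i)) le_rfl
  simp_rw [hterm]
  have h3 := (hasSum_geometric_of_lt_one (r := a / 2) (by linarith [ha01.1])
    (by linarith [ha01.2])).mul_left (1 / 2)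
  have h4 : 1 / 2 * (1 - a / 2)⁻¹ = (2 - a)⁻¹ := by
    rw [one_div, ← mul_inv]
    ring_nf
  rwa [h4] at h3

end Independence

/-! ### Which input variables the visits to a vertex depend on. -/

section Dependence

open Set

/-- The vertex to which an input variable of the model belongs. -/
def siteOf : (ℕ × Bool × List ℕ) ⊕ Vertex → Vertex
  | .inl (k, _, []) => .spine k
  | .inl (k, b, i :: u) => .side k b i u
  | .inr v => v

/-- The position on the path at which the tree containing the vertex is grafted. -/
def Vertex.level : Vertex → ℕ
  | .spine k => k
  | .side k _ _ _ => k

/-- The vertices above a given one. -/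
def above : Vertex → Set Vertex
  | .spine k => {x | k ≤ x.level}
  | .side k b i u => {x | ∃ w, x = .side k b i (u ++ w)}

/-- The indices of the input variables that belong to vertices above `v`. -/
def indicesAbove (v : Vertex) : Set ((ℕ × Bool × List ℕ) ⊕ Vertex) := siteOf ⁻¹' above v

/-- The indices of the variables that belong to the tree number `b` at `k` (where the cars at the
root of that tree are left out). -/
def indicesBranch (k : ℕ) (b : Bool) : Set ((ℕ × Bool × List ℕ) ⊕ Vertex) :=
  insert (.inl (k, b, [])) (siteOf ⁻¹' {x | ∃ i u, x = .side k b i u})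

lemma mem_above_self (v : Vertex) : v ∈ above v := by
  cases v with
  | spine k => exact le_refl k
  | side k b i u => exact ⟨[], by simp⟩

lemma above_concat_subset (k : ℕ) (b : Bool) (i : ℕ) (u : List ℕ) (j : ℕ) :
    above (.side k b i (u ++ [j])) ⊆ above (.side k b i u) := by
  rintro _ ⟨w, rfl⟩
  exact ⟨j :: w, by simp⟩

lemma disjoint_above_concat (k : ℕ) (b : Bool) (i : ℕ) (u : List ℕ) :
    Pairwise (Function.onFun Disjoint fun j => indicesAbove (.side k b i (u ++ [j]))) := by
  intro j j' hne
  refine Disjoint.preimage _ ?_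
  rw [disjoint_left]
  rintro _ ⟨w, rfl⟩ ⟨w', h⟩
  simp at h
  exact hne h.1

lemma disjoint_above_nil (k : ℕ) (b : Bool) :
    Pairwise (Function.onFun Disjoint fun i => indicesAbove (.side k b i [])) := by
  intro j j' hne
  refine Disjoint.preimage _ ?_
  rw [disjoint_left]
  rintro _ ⟨w, rfl⟩ ⟨w', h⟩
  simp at h
  exact hne h.1

lemma notMem_above_concat {x : (ℕ × Bool × List ℕ) ⊕ Vertex} {k : ℕ} {b : Bool} {i : ℕ}
    {u : List ℕ} (h : siteOf x = .side k b i u) (j : ℕ) :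
    x ∉ indicesAbove (.side k b i (u ++ [j])) := by
  rintro ⟨w, hw⟩
  rw [h] at hw
  simp at hw

lemma indicesAbove_nil_subset (k : ℕ) (b : Bool) (i : ℕ) :
    indicesAbove (.side k b i []) ⊆ indicesBranch k b := by
  rintro x ⟨w, hw⟩
  exact .inr ⟨i, w, by simpa using hw⟩

lemma indicesBranch_subset (k : ℕ) (b : Bool) : indicesBranch k b ⊆ indicesAbove (.spine k) := by
  rintro x (rfl | ⟨i, u, h⟩)
  · exact mem_above_self (.spine k)
  · change k ≤ (siteOf x).level
    rw [h]
    exact le_rfl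

/-- `siteOf` sends the child counts of both grafted roots to `spine k`; this is why `indicesBranch`
adds its own root count separately. -/
lemma disjoint_branch (k : ℕ) : Disjoint (indicesBranch k false) (indicesBranch k true) := by
  rw [disjoint_left]
  rintro x (rfl | ⟨i, u, h⟩) (h' | ⟨i', u', h'⟩)
  · simp at h'
  · simp [siteOf] at h'
  · subst h'
    simp [siteOf] at h
  · rw [h] at h'
    simp at h'

lemma disjoint_above_succ_branch (k : ℕ) :
    Disjoint (indicesAbove (.spine (k + 1))) (indicesBranch k false ∪ indicesBranch k true) := by
  have : ∀ b, ∀ x ∈ indicesBranch k b, (siteOf x).level = k := by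
    rintro b x (rfl | ⟨i, u, h⟩)
    · rfl
    · rw [h]
      rfl
  rw [disjoint_left]
  rintro x hx (h | h)
  · have h1 := this _ x h
    change k + 1 ≤ (siteOf x).level at hx
    omega
  · have h1 := this _ x h
    change k + 1 ≤ (siteOf x).level at hx
    omega

lemma disjoint_spine (k : ℕ) : Disjoint {.inr (.spine k)}
    (indicesAbove (.spine (k + 1)) ∪ (indicesBranch k false ∪ indicesBranch k true)) := by
  rw [disjoint_singleton_left]
  rintro (h | (h | ⟨i, u, h⟩) | (h | ⟨i, u, h⟩))
  · change k + 1 ≤ k at h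
    omega
  all_goals simp [siteOf] at h

end Dependence

/-! ### The random model and its generating function recursions. -/

section Visits

open Set

variable {Ω : Type*} {N : ℕ × Bool × List ℕ → Ω → ℕ}
  {P : Vertex → Ω → ℕ}

/-- The number of visits to `v` when the tree is cut `h` levels above `v`, as a random variable. -/
noncomputable def rvisits (N : ℕ × Bool × List ℕ → Ω → ℕ) (P : Vertex → Ω → ℕ) (h : ℕ)
    (v : Vertex) (ω : Ω) : ℕ :=
  visits (children fun x => N x ω) (fun u => P u ω) h v

lemma measurable_sum_range {Ω : Type*} {m : MeasurableSpace Ω} {N : Ω → ℕ} {f : ℕ → Ω → ℕ}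
    (hN : Measurable N) (hf : ∀ n, Measurable (f n)) :
    Measurable fun ω => ∑ i ∈ Finset.range (N ω), (f i ω - 1) :=
  measurable_nat_comp (f := fun n ω => ∑ i ∈ Finset.range n, (f i ω - 1)) hN
    fun _ => Finset.measurable_fun_sum _ fun i _ => (measurable_of_countable (· - 1)).comp (hf i)

/-- Measurability for this small σ-algebra, not just the ambient one, is what makes visits in
disjoint subtrees independent. -/
lemma measurable_rvisits (N : ℕ × Bool × List ℕ → Ω → ℕ) (P : Vertex → Ω → ℕ) (h : ℕ)
    (v : Vertex) : Measurable[sigmaOf (Sum.elim N P) (indicesAbove v)] (rvisits N P h v) := by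
  induction h generalizing v with
  | zero => exact measurable_const (a := 0)
  | succ h ih =>
    have hP : Measurable[sigmaOf (Sum.elim N P) (indicesAbove v)] (P v) :=
      measurable_sigmaOf (ξ := Sum.elim N P) (j := .inr v) (mem_above_self v)
    cases v with
    | spine k =>
      have hN : ∀ b, Measurable[sigmaOf (Sum.elim N P) (indicesAbove (.spine k))] (N (k, b, [])) :=
        fun b => measurable_sigmaOf (ξ := Sum.elim N P) (j := .inl (k, b, []))
          (mem_above_self (.spine k))
      have hb : ∀ b i, Measurable[sigmaOf (Sum.elim N P) (indicesAbove (.spine k))]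
          (rvisits N P h (.side k b i [])) := fun b i =>
        (ih _).mono (sigmaOf_mono _ ((indicesAbove_nil_subset k b i).trans
          (indicesBranch_subset k b))) le_rfl
      have hs : Measurable[sigmaOf (Sum.elim N P) (indicesAbove (.spine k))]
          (rvisits N P h (.spine (k + 1))) :=
        (ih _).mono (sigmaOf_mono _ (preimage_mono fun x (hx : k + 1 ≤ x.level) => (Nat.le_succ k).trans hx)) le_rfl
      have := hP.add (((measurable_of_countable (· - 1)).comp hs).add
        ((measurable_sum_range (hN false) (hb false)).add
          (measurable_sum_range (hN true) (hb true))))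
      have heq : rvisits N P (h + 1) (.spine k) = _ :=
        funext fun ω => visits_spine_succ _ _ h k
      rw [heq]
      exact this
    | side k b i u =>
      have hN : Measurable[sigmaOf (Sum.elim N P) (indicesAbove (.side k b i u))]
          (N (k, b, i :: u)) :=
        measurable_sigmaOf (ξ := Sum.elim N P) (j := .inl (k, b, i :: u))
          (mem_above_self (.side k b i u))
      have hc : ∀ j, Measurable[sigmaOf (Sum.elim N P) (indicesAbove (.side k b i u))]
          (rvisits N P h (.side k b i (u ++ [j]))) := fun j =>
        (ih _).mono (sigmaOf_mono _ (preimage_mono (above_concat_subset k b i u j))) le_rfl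
      have heq : rvisits N P (h + 1) (.side k b i u) = _ :=
        funext fun ω => visits_side_succ _ _ h k b i u
      rw [heq]
      exact hP.add (measurable_sum_range hN hc)

lemma measurable_pow_pred (N : ℕ × Bool × List ℕ → Ω → ℕ) (P : Vertex → Ω → ℕ) (h : ℕ)
    (v : Vertex) (s : ℝ) :
    Measurable[sigmaOf (Sum.elim N P) (indicesAbove v)] fun ω => s ^ (rvisits N P h v ω - 1) :=
  (measurable_of_countable fun n : ℕ => s ^ (n - 1)).comp
    (measurable_rvisits N P h v)

lemma measurable_prod_pow {Ω : Type*} {m : MeasurableSpace Ω} {N : Ω → ℕ} {f : ℕ → Ω → ℝ}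
    (hN : Measurable N) (hf : ∀ n, Measurable (f n)) :
    Measurable fun ω => ∏ i ∈ Finset.range (N ω), f i ω :=
  measurable_nat_comp (f := fun n ω => ∏ i ∈ Finset.range n, f i ω) hN
    fun _ => Finset.measurable_fun_prod _ fun i _ => hf i

lemma pow_pred_mem_Icc (h : ℕ) (v : Vertex) {s : ℝ} (hs : s ∈ Icc (0 : ℝ) 1) (ω : Ω) :
    s ^ (rvisits N P h v ω - 1) ∈ Icc (0 : ℝ) 1 :=
  ⟨pow_nonneg hs.1 _, pow_le_one₀ hs.1 hs.2⟩

lemma measurable_cars_pow (N : ℕ × Bool × List ℕ → Ω → ℕ) (P : Vertex → Ω → ℕ) (v : Vertex)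
    (s : ℝ) : Measurable[sigmaOf (Sum.elim N P) {.inr v}] fun ω => s ^ P v ω :=
  (measurable_of_countable fun n : ℕ => s ^ n).comp
    (measurable_sigmaOf (ξ := Sum.elim N P) (j := .inr v) (mem_singleton _))

lemma measurable_branch (N : ℕ × Bool × List ℕ → Ω → ℕ) (P : Vertex → Ω → ℕ) (h k : ℕ) (b : Bool)
    (s : ℝ) : Measurable[sigmaOf (Sum.elim N P) (indicesBranch k b)] fun ω =>
      ∏ i ∈ Finset.range (N (k, b, []) ω), s ^ (rvisits N P h (.side k b i []) ω - 1) :=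
  measurable_prod_pow
    (measurable_sigmaOf (ξ := Sum.elim N P) (j := .inl (k, b, [])) (mem_insert _ _))
    fun i => (measurable_pow_pred N P h _ s).mono
      (sigmaOf_mono _ (indicesAbove_nil_subset k b i)) le_rfl

lemma rvisits_le_succ (N : ℕ × Bool × List ℕ → Ω → ℕ) (P : Vertex → Ω → ℕ) (h : ℕ) (v : Vertex)
    (ω : Ω) : rvisits N P h v ω ≤ rvisits N P (h + 1) v ω :=
  visits_le_succ _ _ _ _

variable [MeasurableSpace Ω] {μ : Measure Ω} {α : ℝ≥0}

/-- The assumptions on the numbers of children and cars: they are independent random variables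
with geometric and Poisson laws. -/
structure ParkingModel (μ : Measure Ω) (α : ℝ≥0) (N : ℕ × Bool × List ℕ → Ω → ℕ)
    (P : Vertex → Ω → ℕ) : Prop where
  measurable : ∀ j, Measurable (Sum.elim N P j)
  indep : iIndepFun (Sum.elim N P) μ
  law_children : ∀ x, HasLaw (N x) (geometricMeasure half) μ
  law_cars : ∀ v, HasLaw (P v) (poissonMeasure α) μ

namespace ParkingModel

lemma measurable_rvisits (M : ParkingModel μ α N P) (h : ℕ) (v : Vertex) :
    Measurable (rvisits N P h v) :=
  (TreeParking.measurable_rvisits N P h v).mono (sigmaOf_le M.measurable _) le_rfl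

variable [IsProbabilityMeasure μ]

lemma pgf_pred_mem_Icc (M : ParkingModel μ α N P) (h : ℕ) (v : Vertex) {s : ℝ}
    (hs : s ∈ Icc (0 : ℝ) 1) : pgf μ (fun ω => rvisits N P h v ω - 1) s ∈ Icc (0 : ℝ) 1 :=
  ⟨pgf_nonneg hs.1, pgf_le_one ((M.measurable_rvisits h v).sub_const 1) hs⟩

lemma pgf_side_succ (M : ParkingModel μ α N P) (h k : ℕ) (b : Bool) (i : ℕ) (u : List ℕ) {a s : ℝ}
    (hs : s ∈ Icc (0 : ℝ) 1)
    (ha : ∀ j, pgf μ (fun ω => rvisits N P h (.side k b i (u ++ [j])) ω - 1) s = a) :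
    pgf μ (rvisits N P (h + 1) (.side k b i u)) s = Real.exp (-(α * (1 - s))) * (2 - a)⁻¹ := by
  have h1 : pgf μ (rvisits N P (h + 1) (.side k b i u)) s = ∫ ω, s ^ P (.side k b i u) ω *
      ∏ j ∈ Finset.range (N (k, b, i :: u) ω),
        s ^ (rvisits N P h (.side k b i (u ++ [j])) ω - 1) ∂μ := by
    refine integral_congr_ae (.of_forall fun ω => ?_)
    simp only [rvisits]
    rw [visits_side_succ, pow_add, Finset.prod_pow_eq_pow_sum]
  rw [h1, integral_mul_of_disjoint M.measurable M.indep (S := {.inr (.side k b i u)})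
    (T := insert (.inl (k, b, i :: u)) (⋃ j, indicesAbove (.side k b i (u ++ [j])))) _
    (measurable_cars_pow N P _ s)]
  · congr 1
    · exact pgf_poisson (M.law_cars _)
    · exact integral_prod_range_geometric M.measurable M.indep (j := .inl (k, b, i :: u))
        (M.law_children _) (disjoint_above_concat k b i u) (notMem_above_concat rfl)
        (fun j => measurable_pow_pred N P h _ s) (fun j => pow_pred_mem_Icc h _ hs) ha
        (ha 0 ▸ M.pgf_pred_mem_Icc h _ hs)
  · exact measurable_prod_pow
      (measurable_sigmaOf (ξ := Sum.elim N P) (j := .inl (k, b, i :: u)) (mem_insert _ _))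
      fun j => (measurable_pow_pred N P h _ s).mono (sigmaOf_mono _
        ((subset_iUnion (fun j => indicesAbove (.side k b i (u ++ [j]))) j).trans
          (subset_insert _ _))) le_rfl
  · rw [disjoint_singleton_left]
    rintro (h | h)
    · cases h
    · obtain ⟨j, hj⟩ := mem_iUnion.1 h
      exact notMem_above_concat rfl j hj

lemma integral_branch (M : ParkingModel μ α N P) (h k : ℕ) (b : Bool) {a s : ℝ}
    (hs : s ∈ Icc (0 : ℝ) 1)
    (ha : ∀ i, pgf μ (fun ω => rvisits N P h (.side k b i []) ω - 1) s = a) :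
    ∫ ω, ∏ i ∈ Finset.range (N (k, b, []) ω), s ^ (rvisits N P h (.side k b i []) ω - 1) ∂μ =
      (2 - a)⁻¹ := by
  refine integral_prod_range_geometric M.measurable M.indep (j := .inl (k, b, []))
    (M.law_children _) (disjoint_above_nil k b) (fun i => ?_)
    (fun j => measurable_pow_pred N P h _ s) (fun j => pow_pred_mem_Icc h _ hs) ha
    (ha 0 ▸ M.pgf_pred_mem_Icc h _ hs)
  rintro ⟨w, hw⟩
  simp [siteOf] at hw

lemma pgf_spine_succ (M : ParkingModel μ α N P) (h k : ℕ) {a s : ℝ} (hs : s ∈ Icc (0 : ℝ) 1)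
    (ha : ∀ b i, pgf μ (fun ω => rvisits N P h (.side k b i []) ω - 1) s = a) :
    pgf μ (rvisits N P (h + 1) (.spine k)) s = Real.exp (-(α * (1 - s))) *
      (pgf μ (fun ω => rvisits N P h (.spine (k + 1)) ω - 1) s * ((2 - a)⁻¹ * (2 - a)⁻¹)) := by
  have h1 : pgf μ (rvisits N P (h + 1) (.spine k)) s = ∫ ω, s ^ P (.spine k) ω *
      (s ^ (rvisits N P h (.spine (k + 1)) ω - 1) *
      ((∏ i ∈ Finset.range (N (k, false, []) ω), s ^ (rvisits N P h (.side k false i []) ω - 1)) *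
      ∏ i ∈ Finset.range (N (k, true, []) ω),
        s ^ (rvisits N P h (.side k true i []) ω - 1))) ∂μ := by
    refine integral_congr_ae (.of_forall fun ω => ?_)
    simp only [rvisits]
    rw [visits_spine_succ, pow_add, pow_add, pow_add, Finset.prod_pow_eq_pow_sum,
      Finset.prod_pow_eq_pow_sum]
  have hb : Measurable[sigmaOf (Sum.elim N P) (indicesBranch k false ∪ indicesBranch k true)]
      fun ω => (∏ i ∈ Finset.range (N (k, false, []) ω),
        s ^ (rvisits N P h (.side k false i []) ω - 1)) *
      ∏ i ∈ Finset.range (N (k, true, []) ω), s ^ (rvisits N P h (.side k true i []) ω - 1) :=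
    ((measurable_branch N P h k false s).mono (sigmaOf_mono _ subset_union_left) le_rfl).mul
      ((measurable_branch N P h k true s).mono (sigmaOf_mono _ subset_union_right) le_rfl)
  have hsp := measurable_pow_pred N P h (.spine (k + 1)) s
  rw [h1, integral_mul_of_disjoint M.measurable M.indep (disjoint_spine k)
      (measurable_cars_pow N P _ s),
    integral_mul_of_disjoint M.measurable M.indep (disjoint_above_succ_branch k) hsp hb,
    integral_mul_of_disjoint M.measurable M.indep (disjoint_branch k)
      (measurable_branch N P h k false s) (measurable_branch N P h k true s),
    M.integral_branch h k false hs (ha false), M.integral_branch h k true hs (ha true)]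
  · congr 1
    exact pgf_poisson (M.law_cars _)
  · exact (hsp.mono (sigmaOf_mono _ subset_union_left) le_rfl).mul
      (hb.mono (sigmaOf_mono _ subset_union_right) le_rfl)

/-- The law of the number of visits is the same at all vertices of the grafted trees. -/
lemma pgf_pred_side (M : ParkingModel μ α N P) (h k : ℕ) (b : Bool) (i : ℕ) (u : List ℕ) {s : ℝ}
    (hs : s ∈ Icc (0 : ℝ) 1) : pgf μ (fun ω => rvisits N P h (.side k b i u) ω - 1) s =
      pgf μ (fun ω => rvisits N P h (.side 0 false 0 []) ω - 1) s := by
  induction h generalizing k b i u s with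
  | zero => rfl
  | succ h ih =>
    refine pgf_pred_congr (M.measurable_rvisits _ _) (M.measurable_rvisits _ _)
      (fun s hs => ?_) hs
    rw [M.pgf_side_succ h k b i u hs (fun j => ih k b i (u ++ [j]) hs),
      M.pgf_side_succ h 0 false 0 [] hs (fun j => ih 0 false 0 [j] hs)]

/-- The law of the number of visits is the same at all vertices of the path. -/
lemma pgf_pred_spine (M : ParkingModel μ α N P) (h k : ℕ) {s : ℝ} (hs : s ∈ Icc (0 : ℝ) 1) :
    pgf μ (fun ω => rvisits N P h (.spine k) ω - 1) s =
      pgf μ (fun ω => rvisits N P h (.spine 0) ω - 1) s := by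
  induction h generalizing k s with
  | zero => rfl
  | succ h ih =>
    refine pgf_pred_congr (M.measurable_rvisits _ _) (M.measurable_rvisits _ _)
      (fun s hs => ?_) hs
    rw [M.pgf_spine_succ h k hs (fun b i => M.pgf_pred_side h k b i [] hs),
      M.pgf_spine_succ h 0 hs (fun b i => M.pgf_pred_side h 0 b i [] hs),
      ih (k + 1) hs, ih (0 + 1) hs]

lemma pgf_side_succ_eq (M : ParkingModel μ α N P) (h : ℕ) {s : ℝ} (hs : s ∈ Icc (0 : ℝ) 1) :
    pgf μ (rvisits N P (h + 1) (.side 0 false 0 [])) s = Real.exp (-(α * (1 - s))) *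
      (2 - pgf μ (fun ω => rvisits N P h (.side 0 false 0 []) ω - 1) s)⁻¹ :=
  M.pgf_side_succ h 0 false 0 [] hs fun j => M.pgf_pred_side h 0 false 0 [j] hs

/-- Each of the two grafted trees contributes a factor as at a vertex of a grafted tree, so squaring
counts the cars at their common root twice; the positive exponential corrects this. -/
lemma pgf_spine_succ_eq (M : ParkingModel μ α N P) (n : ℕ) {s : ℝ} (hs : s ∈ Icc (0 : ℝ) 1) :
    pgf μ (rvisits N P (n + 1) (.spine 0)) s =
      pgf μ (rvisits N P (n + 1) (.side 0 false 0 [])) s ^ 2 * Real.exp (α * (1 - s)) *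
        pgf μ (fun ω => rvisits N P n (.spine 0) ω - 1) s := by
  rw [M.pgf_spine_succ n 0 hs (fun b i => M.pgf_pred_side n 0 b i [] hs),
    M.pgf_pred_spine n (0 + 1) hs, M.pgf_side_succ_eq n hs, Real.exp_neg]
  field_simp

theorem genFunSystem (M : ParkingModel μ α N P) : GenFunSystem α
    (fun h => pgf μ (rvisits N P h (.side 0 false 0 [])))
    (fun h => pgf μ (fun ω => rvisits N P h (.side 0 false 0 []) ω - 1))
    (fun n s => pgf μ (rvisits N P (n + 1) (.side 0 false 0 [])) s ^ 2 * Real.exp (α * (1 - s)))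
    (fun n => pgf μ (rvisits N P n (.spine 0))) where
  G_nonneg h s hs := pgf_nonneg hs.1
  G_le_one h s hs := pgf_le_one (M.measurable_rvisits _ _) hs
  G_anti h s hs := pgf_anti (M.measurable_rvisits _ _) (M.measurable_rvisits _ _)
    (rvisits_le_succ N P h _) hs
  G_lip h r hr s hs s' hs' := abs_pgf_sub_pgf_le (M.measurable_rvisits _ _) hr hs hs'
  F_nonneg h s hs := (M.pgf_pred_mem_Icc h _ hs).1
  F_le_one h s hs := (M.pgf_pred_mem_Icc h _ hs).2
  G_succ h s hs := by
    have := (M.pgf_pred_mem_Icc h (.side 0 false 0 []) hs).2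
    rw [M.pgf_side_succ_eq h hs, inv_mul_cancel_right₀ (by linarith)]
  mul_F h s hs := mul_pgf_pred (M.measurable_rvisits _ _) hs
  Y_eq n s hs := rfl
  Y_le_one n s hs := by
    have h1 := (M.pgf_pred_mem_Icc n (.side 0 false 0 []) hs).2
    rw [M.pgf_side_succ_eq n hs]
    set f := pgf μ (fun ω => rvisits N P n (.side 0 false 0 []) ω - 1) s
    have h2 : (2 - f)⁻¹ ≤ 1 := inv_le_one_of_one_le₀ (by linarith)
    have h3 : 0 ≤ (2 - f)⁻¹ := inv_nonneg.2 (by linarith)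
    have h4 : Real.exp (-(α * (1 - s))) ≤ 1 :=
      Real.exp_le_one_iff.2 (neg_nonpos.2 (mul_nonneg α.2 (by linarith [hs.2])))
    calc (Real.exp (-(α * (1 - s))) * (2 - f)⁻¹) ^ 2 * Real.exp (α * (1 - s))
        = Real.exp (-(α * (1 - s))) * (2 - f)⁻¹ ^ 2 *
          (Real.exp (-(α * (1 - s))) * Real.exp (α * (1 - s))) := by ring
      _ = Real.exp (-(α * (1 - s))) * (2 - f)⁻¹ ^ 2 := by rw [← Real.exp_add]; simp
      _ ≤ 1 := mul_le_one₀ h4 (sq_nonneg _) (pow_le_one₀ h3 h2)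
  W_nonneg n s hs := pgf_nonneg hs.1
  W_le_one n s hs := pgf_le_one (M.measurable_rvisits _ _) hs
  W_anti n s hs := pgf_anti (M.measurable_rvisits _ _) (M.measurable_rvisits _ _)
    (rvisits_le_succ N P n _) hs
  W_tendsto n := tendsto_pgf_one (M.measurable_rvisits _ _)
  mul_W_succ n s hs := by
    rw [M.pgf_spine_succ_eq n hs, ← mul_pgf_pred (M.measurable_rvisits _ _) hs]
    ring

lemma tendsto_measureReal (M : ParkingModel μ α N P) :
    Filter.Tendsto (fun n => μ.real {ω | rvisits N P n (.spine 0) ω ≤ 1}) Filter.atTop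
      (nhds (μ.real {ω | ∀ n, rvisits N P n (.spine 0) ω ≤ 1})) := by
  have h1 : {ω | ∀ n, rvisits N P n (.spine 0) ω ≤ 1} =
      ⋂ n, {ω | rvisits N P n (.spine 0) ω ≤ 1} := by
    ext ω
    simp
  rw [h1]
  refine (ENNReal.tendsto_toReal (measure_ne_top _ _)).comp (tendsto_measure_iInter_atTop
    (fun n => ((M.measurable_rvisits n _) measurableSet_Iic).nullMeasurableSet)
    (antitone_nat_of_succ_le fun n ω hω => (rvisits_le_succ N P n _ ω).trans hω)
    ⟨0, measure_ne_top _ _⟩)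

/-- The probability that the path is not overcrowded. -/
theorem measureReal_eq (M : ParkingModel μ α N P) :
    μ.real {ω | ∀ n, rvisits N P n (.spine 0) ω ≤ 1} =
      (⨅ n, pgf μ (rvisits N P n (.spine 0)) 0) /
        ((⨅ h, pgf μ (rvisits N P h (.side 0 false 0 [])) 0) ^ 2 * Real.exp α) := by
  have h0 : (0 : ℝ) ∈ Icc (0 : ℝ) 1 := ⟨le_rfl, zero_le_one⟩
  have S := M.genFunSystem
  have hG := (Filter.tendsto_add_atTop_iff_nat 1).2 (S.tendsto_G h0)
  have hW := (Filter.tendsto_add_atTop_iff_nat 1).2 (S.tendsto_W h0)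
  have hpos : 0 < ⨅ h, pgf μ (rvisits N P h (.side 0 false 0 [])) 0 :=
    (half_pos (Real.exp_pos (-α))).trans_le
      (ge_of_tendsto hG (Filter.Eventually.of_forall fun h => S.exp_neg_le h))
  refine tendsto_nhds_unique M.tendsto_measureReal
    ((hW.div ((hG.pow 2).mul_const (Real.exp α)) (by positivity)).congr fun n => ?_)
  have hn : 0 < pgf μ (rvisits N P (n + 1) (.side 0 false 0 [])) 0 :=
    (half_pos (Real.exp_pos (-α))).trans_le (S.exp_neg_le n)
  -- At s = 0 the last factor is the probability that no car leaves the root, that is, of at most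
  -- one visit.
  have h1 := M.pgf_spine_succ_eq n h0
  rw [sub_zero, mul_one, pgf_zero ((M.measurable_rvisits n _).sub_const 1)] at h1
  simp only [Nat.sub_eq_zero_iff_le] at h1
  simp only [Pi.div_apply]
  rw [h1, mul_div_cancel_left₀ _ (by positivity)]

end ParkingModel

end Visits

end TreeParking

/-! ### The parking probability. -/

theorem theorem3 {Ω : Type*} [MeasurableSpace Ω] (μ : Measure Ω) [IsProbabilityMeasure μ]
    (α : ℝ≥0)
    (N : ℕ × Bool × List ℕ → Ω → ℕ) (P : TreeParking.Vertex → Ω → ℕ)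
    (hN : ∀ x, HasLaw (N x) (geometricMeasure TreeParking.half) μ)
    (hP : ∀ v, HasLaw (P v) (poissonMeasure α) μ)
    (hindep : iIndepFun (Sum.elim N P) μ)
    (A : Set Ω)
    (hA : A = {ω | TreeParking.AllCarsPark TreeParking.Vertex.parent
      (TreeParking.carsOn (TreeParking.spineTree fun x => N x ω) fun v => P v ω)}) :
    NullMeasurableSet A μ ∧
      ((α : ℝ) ≤ √2 - 1 → μ.real A =
        √(1 - 2 * (α : ℝ) - (α : ℝ) ^ 2) / ((1 - (α : ℝ)) ^ 2 * Real.exp α)) ∧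
      (√2 - 1 < (α : ℝ) → μ.real A = 0) := by
  -- The inputs are only almost everywhere measurable. Measurable versions agree with them
  -- simultaneously almost surely, because there are countably many; hence `A` is null measurable.
  set N' : ℕ × Bool × List ℕ → Ω → ℕ := fun x => (hN x).aemeasurable.mk (N x) with hN'
  set P' : TreeParking.Vertex → Ω → ℕ := fun v => (hP v).aemeasurable.mk (P v) with hP'
  have hNN : ∀ x, N x =ᵐ[μ] N' x := fun x => (hN x).aemeasurable.ae_eq_mk
  have hPP : ∀ v, P v =ᵐ[μ] P' v := fun v => (hP v).aemeasurable.ae_eq_mk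
  have M : TreeParking.ParkingModel μ α N' P' :=
    { measurable := by
        rintro (x | v)
        · exact (hN x).aemeasurable.measurable_mk
        · exact (hP v).aemeasurable.measurable_mk
      indep := hindep.congr (by
        rintro (x | v)
        · exact hNN x
        · exact hPP v)
      law_children := fun x => (hN x).congr (hNN x).symm
      law_cars := fun v => (hP v).congr (hPP v).symm }
  have hAE : A =ᵐ[μ] {ω | ∀ n, TreeParking.rvisits N' P' n (.spine 0) ω ≤ 1} := by
    filter_upwards [ae_all_iff.2 hNN, ae_all_iff.2 hPP] with ω h1 h2
    apply propext
    rw [hA]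
    change TreeParking.AllCarsPark _ (TreeParking.carsOn (TreeParking.spineTree fun x => N x ω) fun v => P v ω) ↔
      ∀ n, TreeParking.rvisits N' P' n (.spine 0) ω ≤ 1
    rw [TreeParking.allCarsPark_spineTree_iff]
    simp only [TreeParking.rvisits, h1, h2]
  have hmeas : MeasurableSet {ω | ∀ n, TreeParking.rvisits N' P' n (.spine 0) ω ≤ 1} := by
    simp only [Set.ofPred_forall]
    exact MeasurableSet.iInter fun n => M.measurable_rvisits n _ measurableSet_Iic
  have hα : (0 : ℝ) ≤ α := α.2
  have hsq : √2 ^ 2 = (2 : ℝ) := Real.sq_sqrt (by norm_num)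
  have hsq0 : (0 : ℝ) ≤ √2 := Real.sqrt_nonneg 2
  refine ⟨hmeas.nullMeasurableSet.congr hAE.symm, fun h => ?_, fun h => ?_⟩
  · have hαc : 2 * (α : ℝ) + (α : ℝ) ^ 2 ≤ 1 := by nlinarith
    rw [measureReal_congr hAE, M.measureReal_eq, M.genFunSystem.ciInf_W_eq hα hαc,
      M.genFunSystem.ciInf_G_eq hα hαc]
  · have hαc : 1 < 2 * (α : ℝ) + (α : ℝ) ^ 2 := by nlinarith
    rw [measureReal_congr hAE, M.measureReal_eq, M.genFunSystem.ciInf_W_eq_zero hα hαc, zero_div]
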